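/- Let $L>0$ and let $\rho,a\in BV(0,L)$ satisfy $0<\rho_0\le\rho\le\rho_1$ and $0<a_0\le a\le a_1$ a.e. in $(0,L)$, where $\rho_0,\rho_1,a_0,a_1$ are constants; write $a(0)=a(0^+)$ and $a(L)=a(L^-)$. Put $\beta=\operatorname{ess\,sup}_{(0,L)}\sqrt{\rho/a}$ and let $T>L\beta$. Let $H^1_*(0,T)$ be the space of all $s_0\in H^1(0,T)$ with $s_0=0$ on $(0,L\beta)$ and $s_0(T)=0$, let $H^{-1}_*(L\beta,T)$ be its dual, and let $\langle\cdot,\cdot\rangle_*$ be the duality pairing. For $s_0\in H^1_*(0,T)$ let $\psi$, with $(\psi,\psi_t)\in C([0,T];H^1(0,L)\times L^2(0,L))$, be the finite-energy weak solution of the adjoint system $$\rho\psi_{tt}-(a\psi_x)_x=0\ \text{ in }(0,L)\times(0,T),\quad \psi(\cdot,T)=\psi_t(\cdot,T)=0,\quad \psi(0,t)=0,\quad \psi(L,t)=s_0(t),$$ whose trace $\psi_x(0,\cdot)$ is in $L^2(0,T)$. Given $p\in H^{-1}_*(L\beta,T)$, let $$J(s_0)=\frac12\int_0^T\big(a(0)\psi_x(0,t)\big)^2\,dt-a(L)\langle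 s_0,p\rangle_* .$$ Suppose that $\bar s_0\in H^1_*(0,T)$ minimizes $J$ over $H^1_*(0,T)$, and let $\bar\psi$ be the solution of the adjoint system with the boundary datum $\bar s_0$. Then $u(t)=-a(0)\bar\psi_x(0,t)$ is in $L^2(0,T)$, and the solution by transposition $y\in C([0,T];L^2(0,L))$ of $$\rho y_{tt}-(ay_x)_x=0\ \text{ in }(0,L)\times(0,T),\quad y(\cdot,0)=y_t(\cdot,0)=0,\quad y(0,t)=u(t),\quad y(L,t)=0$$ satisfies $y_x(L,\cdot)=p$ on $(L\beta,T)$ in the sense of distributions. Here $y$ is the solution by transposition if $\int_0^T\!\int_0^L yf\,dx\,dt=\int_0^T a(0)\theta_x(0,t)u(t)\,dt$ for every $f\in C([0,T];L^2(0,L))$ and the finite-energy solution $\theta$ of $\rho\theta_{tt}-(a\theta_x)_x=f$, $\theta(\cdot,T)=\theta_t(\cdot,T)=0$, $\theta(0,t)=\theta(L,t)=0$. The traces $w_x(0,\cdot)$, $w_x(L,\cdot)$ are distributions in time: for $\varphi\in C_c^\infty(0,T)$, the value of $w_x(x_0,\cdot)$ at $\varphi$ is the essential limit, as $x\to x_0$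 from within $(0,L)$, of $\frac{d}{dx}\int_0^T w(x,t)\varphi(t)\,dt$. -/

import Mathlib

open MeasureTheory Set Filter Topology
open scoped ContDiff

namespace Sidewise

noncomputable section

/-- The real Hilbert space `L²(0, L)`. -/
abbrev L2 (L : ℝ) : Type := Lp ℝ 2 (volume.restrict (Ioo 0 L))

/-- `v` (through its continuous representative on `[0, b]`) belongs to `H¹(0, b)` and has the weak
derivative `dv`, which is in `L²(0, b)`. -/
def IsH1 (b : ℝ) (v dv : ℝ → ℝ) : Prop :=
  MemLp dv 2 (volume.restrict (Ioo 0 b)) ∧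
    ∀ x ∈ Icc 0 b, v x = v 0 + ∫ ξ in (0 : ℝ)..x, dv ξ

/-- `v` belongs to `H¹₀(0, b)` and has the weak derivative `dv`. -/
def IsH10 (b : ℝ) (v dv : ℝ → ℝ) : Prop :=
  IsH1 b v dv ∧ v 0 = 0 ∧ v b = 0

/-- `φ` is a test function on the open interval `(c, d)`, that is, `φ ∈ C_c^∞(c, d)`. -/
def IsTest (c d : ℝ) (φ : ℝ → ℝ) : Prop :=
  ContDiff ℝ ∞ φ ∧ HasCompactSupport φ ∧ tsupport φ ⊆ Ioo c d

/-- The space `H¹_*(0, T)` of the functions of `H¹(0, T)` which vanish on `(0, c)` and at `t = T`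
(it is used with `c = L β`). -/
def H1Star (c T : ℝ) : Submodule ℝ (ℝ → ℝ) where
  carrier := {s | (∃ ds, IsH1 T s ds) ∧ (∀ t ∈ Icc 0 T, t ≤ c → s t = 0) ∧ s T = 0}
  zero_mem' := ⟨⟨0, MemLp.zero, by simp⟩, by simp, by simp⟩
  add_mem' := by
    rintro s r ⟨⟨ds, h1, h2⟩, h3, h4⟩ ⟨⟨dr, k1, k2⟩, k3, k4⟩
    refine ⟨⟨ds + dr, h1.add k1, fun x hx => ?_⟩, fun t ht htc => ?_, ?_⟩
    · have key : ∀ f : ℝ → ℝ, MemLp f 2 (volume.restrict (Ioo 0 T)) →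
          IntervalIntegrable f volume 0 x := by
        intro f hf
        rw [intervalIntegrable_iff_integrableOn_Ioo_of_le hx.1]
        have : IntegrableOn f (Ioo 0 T) := hf.integrable (by norm_num)
        exact this.mono_set (Ioo_subset_Ioo_right hx.2)
      have := intervalIntegral.integral_add (key ds h1) (key dr k1)
      simp only [Pi.add_apply]
      rw [this, h2 x hx, k2 x hx]
      ring
    · simp [h3 t ht htc, k3 t ht htc]
    · simp [h4, k4]
  smul_mem' := by
    rintro k s ⟨⟨ds, h1, h2⟩, h3, h4⟩
    refine ⟨⟨k • ds, h1.const_smul k, fun x hx => ?_⟩, fun t ht htc => ?_, ?_⟩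
    · simp only [Pi.smul_apply, smul_eq_mul, intervalIntegral.integral_const_mul]
      rw [h2 x hx]
      ring
    · simp [h3 t ht htc]
    · simp [h4]

theorem IsTest.mem_H1Star {c T : ℝ} {φ : ℝ → ℝ} (h : IsTest c T φ) : φ ∈ H1Star c T := by
  obtain ⟨h1, h2, h3⟩ := h
  have hd : Continuous (deriv φ) := h1.continuous_deriv (by simp)
  have hz : ∀ t, t ∉ Ioo c T → φ t = 0 := fun t ht =>
    image_eq_zero_of_notMem_tsupport fun h => ht (h3 h)
  refine ⟨⟨deriv φ, ?_, fun x _ => ?_⟩, fun t _ htc => hz t fun h => absurd h.1 (not_lt.2 htc),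
    hz T fun h => lt_irrefl _ h.2⟩
  · exact (hd.memLp_of_hasCompactSupport h2.deriv).restrict _
  · rw [intervalIntegral.integral_deriv_eq_sub
      (fun t _ => (h1.differentiable (by simp)).differentiableAt) (hd.intervalIntegrable _ _)]
    ring

/-- The linear functional `p` on `H¹_*(0, T)` is continuous for the norm of `H¹(0, T)`, that is,
`p` belongs to the dual `H⁻¹_*(c, T)`. The pairing `⟨s, p⟩_*` is `p s`. -/
def IsDual {c T : ℝ} (p : H1Star c T →ₗ[ℝ] ℝ) : Prop :=
  ∃ C : ℝ, ∀ (s : H1Star c T) (ds : ℝ → ℝ), IsH1 T s ds →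
    |p s| ≤ C * √((∫ t in (0 : ℝ)..T, s.1 t ^ 2) + ∫ t in (0 : ℝ)..T, ds t ^ 2)

/-- `β = ess sup_{(0, L)} √(ρ / a)`. -/
def beta (L : ℝ) (ρ a : ℝ → ℝ) : ℝ :=
  essSup (fun x => √(ρ x / a x)) (volume.restrict (Ioo 0 L))

/-- `w` belongs to `H¹(0, L)` and has the weak derivative `z`. -/
def HasWeakDeriv {L : ℝ} (w z : L2 L) : Prop :=
  ∃ k : ℝ, ∀ᵐ x ∂(volume.restrict (Ioo 0 L)), w x = k + ∫ ξ in (0 : ℝ)..x, z ξ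

/-- Let `w : [0, T] → L²(0, L)`, and let `φ` be a test function of time. This says that the
function `w_φ = ∫₀ᵀ φ(t) w(·, t) dt` of `x` has a weak derivative, and that `∂ₓ w_φ (x)` has the
essential limit `c` as `x` goes to an end point of `(0, L)` (from the right to `0` if `l` is
`𝓝[>] 0`, from the left to `L` if `l` is `𝓝[<] L`). Thus `c` is the value at `φ` of the trace of
`∂ₓ w` at that end point, the trace being taken in the sense of distributions of time. -/
def HasDxTrace {L : ℝ} (T : ℝ) (l : Filter ℝ) (w : ℝ → L2 L) (φ : ℝ → ℝ) (c : ℝ) : Prop :=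
  ∃ z : L2 L, HasWeakDeriv (∫ t in (0 : ℝ)..T, φ t • w t) z ∧
    Tendsto (fun x => z x) (l ⊓ ae volume) (𝓝 c)

/-- The trace `∂ₓ w (0, ·)` (as a distribution on `(0, T)`) is the function `g ∈ L²(0, T)`. -/
def HasDxTraceZero {L : ℝ} (T : ℝ) (w : ℝ → L2 L) (g : ℝ → ℝ) : Prop :=
  MemLp g 2 (volume.restrict (Ioo 0 T)) ∧
    ∀ φ, IsTest 0 T φ → HasDxTrace T (𝓝[>] 0) w φ (∫ t in (0 : ℝ)..T, g t * φ t)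

/-- `θ` is a finite-energy solution, `(θ, θ_t) ∈ C([0, T]; H¹(0, L) × L²(0, L))`, of the backward
problem
`ρ θ_tt - (a θ_x)_x = f`, `θ(·, T) = θ_t(·, T) = 0`, `θ(0, t) = 0`, `θ(L, t) = s(t)`. -/
def IsFiniteEnergySolution {L : ℝ} (T : ℝ) (ρ a : ℝ → ℝ) (f : ℝ → L2 L) (s : ℝ → ℝ)
    (θ : ℝ → L2 L) : Prop :=
  ∃ θx θt : ℝ → L2 L,
    ContinuousOn θ (Icc 0 T) ∧ ContinuousOn θx (Icc 0 T) ∧ ContinuousOn θt (Icc 0 T) ∧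
    -- `θx` is the space derivative, and the two boundary conditions hold
    (∀ t ∈ Icc 0 T,
      (∀ᵐ x ∂(volume.restrict (Ioo 0 L)), θ t x = ∫ ξ in (0 : ℝ)..x, θx t ξ) ∧
      ∫ ξ in (0 : ℝ)..L, θx t ξ = s t) ∧
    -- `θt` is the time derivative
    (∀ t ∈ Icc 0 T, HasDerivWithinAt θ (θt t) (Icc 0 T) t) ∧
    -- the final conditions
    θ T = 0 ∧ θt T = 0 ∧
    -- the equation, tested with the functions of `H¹₀(0, L)`
    (∀ v dv, IsH10 L v dv → ∀ t ∈ Icc 0 T,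
      HasDerivWithinAt (fun τ => ∫ x in Ioo 0 L, ρ x * θt τ x * v x)
        ((∫ x in Ioo 0 L, f t x * v x) - ∫ x in Ioo 0 L, a x * θx t x * dv x) (Icc 0 T) t)

/-- `ψ` is a finite-energy solution of the adjoint system with the boundary datum `s`. -/
def IsAdjointSolution {L : ℝ} (T : ℝ) (ρ a : ℝ → ℝ) (s : ℝ → ℝ) (ψ : ℝ → L2 L) : Prop :=
  IsFiniteEnergySolution T ρ a (fun _ => 0) s ψ

/-- `y ∈ C([0, T]; L²(0, L))` is the solution, in the sense of transposition, of
`ρ y_tt - (a y_x)_x = 0`, `y(·, 0) = y_t(·, 0) = 0`, `y(0, t) = u(t)`, `y(L, t) = 0`: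
`∫₀ᵀ ∫₀ᴸ y f dx dt = ∫₀ᵀ a(0) θ_x(0, t) u(t) dt` whenever `θ` solves the backward problem with the
source `f` and homogeneous boundary and final data. The boundary value `a(0)` of the `BV` function
`a` is its limit from within `(0, L)`. -/
def IsTranspositionSolution {L : ℝ} (T : ℝ) (ρ a u : ℝ → ℝ) (y : ℝ → L2 L) : Prop :=
  ContinuousOn y (Icc 0 T) ∧
    ∀ (f θ : ℝ → L2 L) (g : ℝ → ℝ), ContinuousOn f (Icc 0 T) →
      IsFiniteEnergySolution T ρ a f (fun _ => 0) θ → HasDxTraceZero T θ g →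
        ∫ t in (0 : ℝ)..T, inner ℝ (y t) (f t) =
          ∫ t in (0 : ℝ)..T, Function.rightLim a 0 * g t * u t

/-- The value of the functional
`J(s) = ½ ∫₀ᵀ (a(0) ψ_x(0, t))² dt - a(L) ⟨s, p⟩_*`, where `g = ψ_x(0, ·)`. -/
def J (L : ℝ) {c T : ℝ} (a : ℝ → ℝ) (p : H1Star c T →ₗ[ℝ] ℝ) (s : H1Star c T) (g : ℝ → ℝ) : ℝ :=
  1 / 2 * (∫ t in (0 : ℝ)..T, (Function.rightLim a 0 * g t) ^ 2) - Function.leftLim a L * p s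

/-- `g = ψ_x(0, ·)`, where `ψ` is the solution of the adjoint system with the boundary datum `s`. -/
def IsAdjointTrace (L T : ℝ) (ρ a s g : ℝ → ℝ) : Prop :=
  ∃ ψ : ℝ → L2 L, IsAdjointSolution T ρ a s ψ ∧ HasDxTraceZero T ψ g

end

end Sidewise

namespace Sidewise

/-! Let `S` be the Green operator of `-(a w')'` with Dirichlet conditions on `(0, L)`, and let `ℓ`
be the `a`-harmonic function with `ℓ(0) = 0`, `ℓ(L) = 1` (`WaveOperators.lift`). A time-regular `θ`
with `θ = S (f - ρ θ'') + s ℓ` is a finite-energy solution with source `f` and datum `s`, and its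
flux at `x = 0` is explicit (`isFiniteEnergySolution_of_eq`, `hasDxTraceZero_of_eq`).

For a test function `φ`, an adjoint solution with datum `φ` is `ψ = θ + φ ℓ`, where `θ` has
homogeneous boundary data and source `-φ'' ρ ℓ`. It comes from `exists_homogeneous_part`, which
rests on the abstract equation `S R x'' + x = c` solved in `exists_evolution`. Since `sbar + k φ` is
an admissible competitor for every real `k`, `euler_lagrange` gives `-∫ u a(0) ψ_x(0, ·) = a(L)
p(φ)`.

On the other side put `Y = ∫ φ y`, `Y2 = ∫ φ'' y`, `U = ∫ u φ`. Transposition against the separated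
functions `φ(t) S g`, with `g` arbitrary, yields `Y = U (1 - ℓ) - S (ρ Y2)`. Thus `Y` is in `H¹(0,
L)`, solves an elliptic problem, and has a flux at `L` equal to `-κ U + ⟨ρ Y2, ℓ⟩`, because minus
the flux of `S g` at `L` is `⟨ℓ, g⟩` (`fluxRight_eq_inner_lift`). Transposition against `θ`
identifies `⟨ρ Y2, ℓ⟩` with `-∫ u a(0) θ_x(0, ·)`. The flux of `φ ℓ` at `0` is `κ φ`, so the two
terms add up to `-∫ u a(0) ψ_x(0, ·)`, which is `a(L) p(φ)`. Only existence of `ψ` is needed, not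
its uniqueness. -/

/-! ### Multiplication and integration operators on `L²(0, L)`. -/

theorem inner_eq_setIntegral {L : ℝ} (f g : L2 L) :
    inner ℝ f g = ∫ x in Ioo 0 L, f x * g x := by
  rw [L2.inner_def]
  exact integral_congr_ae (ae_of_all _ fun x => by simp [mul_comm])

/-- Multiplication by an essentially bounded function, as a bounded operator on `L²(0, L)`. -/
theorem exists_mulOp {L C : ℝ} {m : ℝ → ℝ}
    (hm : AEStronglyMeasurable m (volume.restrict (Ioo 0 L)))
    (hb : ∀ᵐ x ∂(volume.restrict (Ioo 0 L)), |m x| ≤ C) :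
    ∃ M : L2 L →L[ℝ] L2 L, ∀ g : L2 L,
      ∀ᵐ x ∂(volume.restrict (Ioo 0 L)), M g x = m x * g x := by
  have hmem : ∀ g : L2 L, MemLp (fun x => m x * g x) 2 (volume.restrict (Ioo 0 L)) := fun g => by
    refine (Lp.memLp g).of_le_mul (c := C) (hm.mul (Lp.aestronglyMeasurable g)) ?_
    filter_upwards [hb] with x hx
    rw [norm_mul]
    exact mul_le_mul_of_nonneg_right hx (norm_nonneg _)
  have hcoe : ∀ g, ((hmem g).toLp _ : ℝ → ℝ) =ᵐ[volume.restrict (Ioo 0 L)]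
      fun x => m x * g x := fun g => (hmem g).coeFn_toLp
  refine ⟨LinearMap.mkContinuous
    { toFun := fun g => (hmem g).toLp _
      map_add' := fun f g => ?_
      map_smul' := fun k g => ?_ } C fun g => ?_, hcoe⟩
  · refine Lp.ext ?_
    filter_upwards [hcoe (f + g), hcoe f, hcoe g, Lp.coeFn_add f g,
      Lp.coeFn_add ((hmem f).toLp _) ((hmem g).toLp _)] with x h1 h2 h3 h4 h5
    rw [h1, h5, Pi.add_apply, h2, h3, h4, Pi.add_apply, mul_add]
  · refine Lp.ext ?_
    filter_upwards [hcoe (k • g), hcoe g, Lp.coeFn_smul k g,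
      Lp.coeFn_smul k ((hmem g).toLp _)] with x h1 h2 h3 h4
    rw [h1, RingHom.id_apply, h4, Pi.smul_apply, h2, h3, Pi.smul_apply, smul_eq_mul, smul_eq_mul]
    ring
  · refine Lp.norm_le_mul_norm_of_ae_le_mul ?_
    filter_upwards [hb, hcoe g] with x h1 h2
    simp only [LinearMap.coe_mk, AddHom.coe_mk]
    rw [h2, norm_mul]
    exact mul_le_mul_of_nonneg_right h1 (norm_nonneg _)

/-- The constant function `1` as an element of `L²(0, L)`. -/
noncomputable def one (L : ℝ) : L2 L :=
  indicatorConstLp 2 MeasurableSet.univ (measure_ne_top (volume.restrict (Ioo 0 L)) _) (1 : ℝ)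

theorem coeFn_one (L : ℝ) : ∀ᵐ x ∂(volume.restrict (Ioo 0 L)), one L x = 1 := by
  filter_upwards [indicatorConstLp_coeFn (p := 2) (hs := MeasurableSet.univ)
    (hμs := measure_ne_top (volume.restrict (Ioo 0 L)) _) (c := (1 : ℝ))] with x hx
  rw [one, hx]
  simp

theorem L2.integrableOn {L : ℝ} (g : L2 L) : IntegrableOn g (Ioo 0 L) :=
  (Lp.memLp g).integrable (by norm_num)

theorem L2.intervalIntegrable {L : ℝ} (g : L2 L) {x y : ℝ} (hx : x ∈ Icc 0 L) (hy : y ∈ Icc 0 L) :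
    IntervalIntegrable g volume x y := by
  have h : IntegrableOn g (Icc 0 L) := (integrableOn_Icc_iff_integrableOn_Ioo).2 (L2.integrableOn g)
  exact (h.mono_set (ordConnected_Icc.uIcc_subset hx hy)).intervalIntegrable

theorem inner_one_left {L : ℝ} (hL : 0 < L) (g : L2 L) :
    inner ℝ (one L) g = ∫ x in (0 : ℝ)..L, g x := by
  rw [inner_eq_setIntegral, intervalIntegral.integral_of_le hL.le,
    ← setIntegral_congr_set (Ioo_ae_eq_Ioc (μ := volume))]
  refine integral_congr_ae ?_
  filter_upwards [coeFn_one L] with x hx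
  rw [hx, one_mul]

theorem L2.continuousOn_primitive {L : ℝ} (g : L2 L) :
    ContinuousOn (fun x => ∫ ξ in (0 : ℝ)..x, g ξ) (Icc 0 L) := by
  have h : IntegrableOn g (Icc 0 L) := (integrableOn_Icc_iff_integrableOn_Ioo).2 (L2.integrableOn g)
  rcases le_or_gt 0 L with hL | hL
  · rw [← uIcc_of_le hL] at h ⊢
    exact intervalIntegral.continuousOn_primitive_interval h
  · simp [Icc_eq_empty (not_le.2 hL)]

/-- Cauchy–Schwarz against the indicator of `(0, x]`, whose norm is at most `√L`. -/
theorem L2.abs_primitive_le {L : ℝ} (g : L2 L) {x : ℝ} (hx : x ∈ Ioo 0 L) :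
    |∫ ξ in (0 : ℝ)..x, g ξ| ≤ √L * ‖g‖ := by
  have h1 : ∫ ξ in (0 : ℝ)..x, g ξ = ∫ ξ in Ioc 0 x, g ξ ∂(volume.restrict (Ioo 0 L)) := by
    rw [intervalIntegral.integral_of_le hx.1.le, Measure.restrict_restrict measurableSet_Ioc,
      inter_eq_left.2 (show Ioc 0 x ⊆ Ioo 0 L from fun y hy => ⟨hy.1, hy.2.trans_lt hx.2⟩)]
  have hm : (volume.restrict (Ioo 0 L)) (Ioc 0 x) ≠ ⊤ := measure_ne_top _ _
  rw [h1, ← L2.inner_indicatorConstLp_one (𝕜 := ℝ) measurableSet_Ioc hm g]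
  refine (abs_real_inner_le_norm _ _).trans (mul_le_mul_of_nonneg_right ?_ (norm_nonneg _))
  rw [norm_indicatorConstLp (by norm_num) (by norm_num), norm_one, one_mul, Real.sqrt_eq_rpow,
    ENNReal.toReal_ofNat]
  refine Real.rpow_le_rpow measureReal_nonneg ?_ (by norm_num)
  calc (volume.restrict (Ioo 0 L)).real (Ioc 0 x) ≤ (volume.restrict (Ioo 0 L)).real univ :=
        measureReal_mono (subset_univ _)
    _ = L := by simp [hx.1.le.trans hx.2.le]

/-- The Volterra operator `g ↦ ∫₀ˣ g` on `L²(0, L)`. -/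
theorem exists_volterra (L : ℝ) :
    ∃ P : L2 L →L[ℝ] L2 L, ∀ g : L2 L,
      ∀ᵐ x ∂(volume.restrict (Ioo 0 L)), P g x = ∫ ξ in (0 : ℝ)..x, g ξ := by
  have hbd : ∀ g : L2 L, ∀ᵐ x ∂(volume.restrict (Ioo 0 L)),
      |∫ ξ in (0 : ℝ)..x, g ξ| ≤ √L * ‖g‖ := fun g =>
    (ae_restrict_iff' measurableSet_Ioo).2 (ae_of_all _ fun x hx => L2.abs_primitive_le g hx)
  have hmem : ∀ g : L2 L, MemLp (fun x => ∫ ξ in (0 : ℝ)..x, g ξ) 2 (volume.restrict (Ioo 0 L)) :=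
    fun g => MemLp.of_bound (((L2.continuousOn_primitive g).mono
      Ioo_subset_Icc_self).aestronglyMeasurable measurableSet_Ioo) _ (hbd g)
  have hcoe : ∀ g, ((hmem g).toLp _ : ℝ → ℝ) =ᵐ[volume.restrict (Ioo 0 L)]
      fun x => ∫ ξ in (0 : ℝ)..x, g ξ := fun g => (hmem g).coeFn_toLp
  have hin : ∀ᵐ x ∂(volume.restrict (Ioo 0 L)), x ∈ Ioo 0 L := ae_restrict_mem measurableSet_Ioo
  have hcongr : ∀ f g : ℝ → ℝ, f =ᵐ[volume.restrict (Ioo 0 L)] g → ∀ x ∈ Ioo 0 L,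
      ∫ ξ in (0 : ℝ)..x, f ξ = ∫ ξ in (0 : ℝ)..x, g ξ := fun f g h x hx => by
    refine intervalIntegral.integral_congr_ae ?_
    rw [EventuallyEq, ae_restrict_iff' measurableSet_Ioo] at h
    filter_upwards [h] with y hy hyx
    rw [uIoc_of_le hx.1.le] at hyx
    exact hy ⟨hyx.1, hyx.2.trans_lt hx.2⟩
  have hI : ∀ (g : L2 L), ∀ x ∈ Ioo 0 L, IntervalIntegrable g volume 0 x := fun g x hx =>
    L2.intervalIntegrable g ⟨le_rfl, (hx.1.trans hx.2).le⟩ ⟨hx.1.le, hx.2.le⟩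
  let P : L2 L →ₗ[ℝ] L2 L :=
    { toFun := fun g => (hmem g).toLp _
      map_add' := fun f g => by
        refine Lp.ext ?_
        filter_upwards [hcoe (f + g), hcoe f, hcoe g, hin,
          Lp.coeFn_add ((hmem f).toLp _) ((hmem g).toLp _)] with x h1 h2 h3 h4 h5
        rw [h1, h5, Pi.add_apply, h2, h3, hcongr _ _ (Lp.coeFn_add f g) x h4]
        exact intervalIntegral.integral_add (hI f x h4) (hI g x h4)
      map_smul' := fun k g => by
        refine Lp.ext ?_
        filter_upwards [hcoe (k • g), hcoe g, hin,
          Lp.coeFn_smul k ((hmem g).toLp _)] with x h1 h2 h3 h4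
        rw [h1, RingHom.id_apply, h4, Pi.smul_apply, h2, hcongr _ _ (Lp.coeFn_smul k g) x h3]
        exact intervalIntegral.integral_const_mul _ _ }
  refine ⟨P.mkContinuous (√L * ‖one L‖) fun g => ?_, hcoe⟩
  have h : ‖P g‖ ≤ √L * ‖g‖ * ‖one L‖ := by
    refine Lp.norm_le_mul_norm_of_ae_le_mul ?_
    filter_upwards [hbd g, hcoe g, coeFn_one L] with x h1 h2 h3
    rw [h3, norm_one, mul_one]
    exact (congrArg norm h2).trans_le h1
  exact h.trans_eq (by ring)

/-- Integration by parts on `(0, L)`. -/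
theorem inner_volterra_add {L : ℝ} (hL : 0 < L) {P : L2 L →L[ℝ] L2 L}
    (hP : ∀ g : L2 L, ∀ᵐ x ∂(volume.restrict (Ioo 0 L)), P g x = ∫ ξ in (0 : ℝ)..x, g ξ)
    (f g : L2 L) :
    inner ℝ (P f) g + inner ℝ f (P g) = inner ℝ (one L) f * inner ℝ (one L) g := by
  have hf := L2.intervalIntegrable f (left_mem_Icc.2 hL.le) (right_mem_Icc.2 hL.le)
  have hg := L2.intervalIntegrable g (left_mem_Icc.2 hL.le) (right_mem_Icc.2 hL.le)
  -- Both primitives are absolutely continuous and vanish at `0`, so only the boundary term at `L`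
  -- survives.
  have key := AbsolutelyContinuousOnInterval.integral_deriv_mul_eq_sub
    (hf.absolutelyContinuousOnInterval_intervalIntegral left_mem_uIcc)
    (hg.absolutelyContinuousOnInterval_intervalIntegral left_mem_uIcc)
  simp only [intervalIntegral.integral_same, mul_zero, sub_zero] at key
  rw [inner_one_left hL, inner_one_left hL, ← key, intervalIntegral.integral_of_le hL.le,
    ← setIntegral_congr_set (Ioo_ae_eq_Ioc (μ := volume)), L2.inner_def, L2.inner_def,
    ← integral_add (L2.integrable_inner _ _) (L2.integrable_inner _ _)]
  refine integral_congr_ae ?_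
  filter_upwards [hP f, hP g, ae_restrict_of_ae hf.ae_hasDerivAt_integral,
    ae_restrict_of_ae hg.ae_hasDerivAt_integral, ae_restrict_mem measurableSet_Ioo]
    with x h1 h2 h3 h4 h5
  have hx : x ∈ uIcc 0 L := by rw [uIcc_of_le hL.le]; exact ⟨h5.1.le, h5.2.le⟩
  rw [(h3 hx 0 left_mem_uIcc).deriv, (h4 hx 0 left_mem_uIcc).deriv, h1, h2]
  simp
  ring

/-! ### End-point limits of `BV` coefficients, and essential limits. -/

theorem aemeasurable_of_boundedVariationOn {L : ℝ} {f : ℝ → ℝ}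
    (h : BoundedVariationOn f (Ioo 0 L)) : AEMeasurable f (volume.restrict (Ioo 0 L)) := by
  obtain ⟨p, q, hp, hq, rfl⟩ :=
    h.locallyBoundedVariationOn.exists_monotoneOn_sub_monotoneOn
  exact (aemeasurable_restrict_of_monotoneOn measurableSet_Ioo hp).sub
    (aemeasurable_restrict_of_monotoneOn measurableSet_Ioo hq)

theorem nhdsWithin_inter_Ioi_zero {L : ℝ} (hL : 0 < L) : 𝓝[Ioo 0 L ∩ Ioi 0] (0 : ℝ) = 𝓝[>] 0 := by
  rw [inter_eq_left.2 fun x hx => hx.1]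
  exact nhdsWithin_Ioo_eq_nhdsGT hL

theorem nhdsWithin_inter_Iio {L : ℝ} (hL : 0 < L) : 𝓝[Ioo 0 L ∩ Iio L] L = 𝓝[<] L := by
  rw [inter_eq_left.2 fun x hx => hx.2]
  exact nhdsWithin_Ioo_eq_nhdsLT hL

theorem tendsto_rightLim_zero {L : ℝ} (hL : 0 < L) {f : ℝ → ℝ}
    (h : BoundedVariationOn f (Ioo 0 L)) :
    Tendsto f (𝓝[>] 0) (𝓝 (Function.rightLim f 0)) := by
  obtain ⟨l, hl⟩ := h.exists_tendsto_right 0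
  rw [nhdsWithin_inter_Ioi_zero hL] at hl
  exact tendsto_rightLim_of_tendsto ⟨l, hl⟩

theorem tendsto_leftLim_right_end {L : ℝ} (hL : 0 < L) {f : ℝ → ℝ}
    (h : BoundedVariationOn f (Ioo 0 L)) :
    Tendsto f (𝓝[<] L) (𝓝 (Function.leftLim f L)) := by
  obtain ⟨l, hl⟩ := h.exists_tendsto_left L
  rw [nhdsWithin_inter_Iio hL] at hl
  exact tendsto_leftLim_of_tendsto ⟨l, hl⟩

theorem eventually_inf_ae_of_ae_restrict {L : ℝ} {l : Filter ℝ} (hl : Ioo 0 L ∈ l) {q : ℝ → Prop}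
    (h : ∀ᵐ x ∂(volume.restrict (Ioo 0 L)), q x) : ∀ᶠ x in l ⊓ ae volume, q x := by
  rw [ae_restrict_iff' measurableSet_Ioo] at h
  filter_upwards [h.filter_mono inf_le_right, mem_inf_of_left hl] with x hx hx'
  exact hx hx'

/-- Every interval `(0, u)` with `u > 0` has positive measure. This lets an a.e. lower bound on `a`
pass to the limit `a(0⁺)`. -/
theorem neBot_inf_ae_zero : (𝓝[>] (0 : ℝ) ⊓ ae volume).NeBot := by
  rw [inf_neBot_iff]
  intro s hs t ht
  obtain ⟨u, hu, hus⟩ := mem_nhdsGT_iff_exists_Ioo_subset.1 hs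
  by_contra h
  have h1 : Ioo 0 u ⊆ tᶜ := fun x hx hxt => h ⟨x, hus hx, hxt⟩
  have h2 := measure_mono_null h1 ht
  rw [Real.volume_Ioo, ENNReal.ofReal_eq_zero] at h2
  exact absurd h2 (not_le.2 (by simpa using hu))

theorem neBot_inf_ae_left (L : ℝ) : (𝓝[<] L ⊓ ae volume).NeBot := by
  rw [inf_neBot_iff]
  intro s hs t ht
  obtain ⟨u, hu, hus⟩ := mem_nhdsLT_iff_exists_Ioo_subset.1 hs
  by_contra h
  have h1 : Ioo u L ⊆ tᶜ := fun x hx hxt => h ⟨x, hus hx, hxt⟩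
  have h2 := measure_mono_null h1 ht
  rw [Real.volume_Ioo, ENNReal.ofReal_eq_zero] at h2
  exact absurd h2 (not_le.2 (by simpa using hu))

theorem beta_nonneg {L : ℝ} (hL : 0 < L) (ρ a : ℝ → ℝ) : 0 ≤ beta L ρ a := by
  have : (ae (volume.restrict (Ioo 0 L))).NeBot := by
    rw [ae_neBot, Ne, Measure.restrict_eq_zero, Real.volume_Ioo]
    simpa using hL
  rw [beta, essSup, limsup_eq]
  -- An essential upper bound of a square root is nonnegative because it is attained as a bound at
  -- some point; an empty set of bounds would have `sInf` equal to `0`.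
  refine Real.sInf_nonneg fun b hb => ?_
  obtain ⟨x, hx⟩ := (show ∀ᶠ x in ae (volume.restrict (Ioo 0 L)), √(ρ x / a x) ≤ b from hb).exists
  exact (Real.sqrt_nonneg _).trans hx

/-! ### The abstract equation `S R x'' + x = c` in a Hilbert space. -/

/-- Lax–Milgram for the form `⟨A x, y⟩`; uniqueness of the representing operator identifies it with
`A`. -/
theorem exists_rightInverse_of_coercive {H : Type*} [NormedAddCommGroup H] [InnerProductSpace ℝ H]
    [CompleteSpace H] {A : H →L[ℝ] H} {c : ℝ} (hc : 0 < c)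
    (hA : ∀ x, c * ‖x‖ ^ 2 ≤ inner ℝ (A x) x) : ∃ B : H →L[ℝ] H, ∀ x, A (B x) = x := by
  have hco : IsCoercive ((innerSL ℝ).comp A) := ⟨c, hc, fun x => by
    have := hA x
    simp only [ContinuousLinearMap.comp_apply, innerSL_apply_apply]
    nlinarith⟩
  refine ⟨hco.continuousLinearEquivOfBilin.symm.toContinuousLinearMap, fun x => ?_⟩
  have h : A (hco.continuousLinearEquivOfBilin.symm x) =
      hco.continuousLinearEquivOfBilin (hco.continuousLinearEquivOfBilin.symm x) :=
    hco.unique_continuousLinearEquivOfBilin fun w => by simp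
  simpa using h

/-- An inhomogeneous linear differential equation with a bounded operator has a solution on the
whole line, with zero datum at `T`. -/
theorem exists_linear_ode {E : Type*} [NormedAddCommGroup E] [NormedSpace ℝ E] [CompleteSpace E]
    (M : E →L[ℝ] E) {F : ℝ → E} (hF : Continuous F) (T : ℝ) :
    ∃ X : ℝ → E, X T = 0 ∧ ∀ t, HasDerivAt X (M (X t) + F t) t := by
  have hexp : ∀ t : ℝ, HasDerivAt (fun s : ℝ => NormedSpace.exp (s • M))
      (M * NormedSpace.exp (t • M)) t := fun t => hasDerivAt_exp_smul_const' M t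
  have hcont : Continuous fun s : ℝ => NormedSpace.exp (s • M) :=
    continuous_iff_continuousAt.2 fun t => (hexp t).continuousAt
  have hG : Continuous fun s : ℝ => NormedSpace.exp ((-s) • M) (F s) :=
    (hcont.comp continuous_neg).clm_apply hF
  have hinv : ∀ t : ℝ, NormedSpace.exp (t • M) * NormedSpace.exp ((-t) • M) = 1 := fun t => by
    let _ : NormedAlgebra ℚ (E →L[ℝ] E) := NormedAlgebra.restrictScalars ℚ ℝ _
    rw [← NormedSpace.exp_add_of_commute ((Commute.refl M).smul_left t |>.smul_right (-t)),
      ← add_smul, add_neg_cancel, zero_smul, NormedSpace.exp_zero]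
  -- Variation of constants.
  refine ⟨fun t => NormedSpace.exp (t • M) (∫ s in T..t, NormedSpace.exp ((-s) • M) (F s)),
    by simp, fun t => ?_⟩
  have h := (hexp t).clm_apply (hG.integral_hasStrictDerivAt T t).hasDerivAt
  refine h.congr_deriv ?_
  rw [← mul_apply_eq_comp (NormedSpace.exp (t • M)), hinv]
  simp

/-- Reduction to the first-order system `(x, v)' = (v, B c - B x)` on `H × H`. -/
theorem exists_second_order_ode {H : Type*} [NormedAddCommGroup H] [NormedSpace ℝ H]
    [CompleteSpace H] (B : H →L[ℝ] H) {c : ℝ → H} (hc : Continuous c) (T : ℝ) :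
    ∃ x v : ℝ → H, x T = 0 ∧ v T = 0 ∧ (∀ t, HasDerivAt x (v t) t) ∧
      ∀ t, HasDerivAt v (B (c t - x t)) t := by
  obtain ⟨X, hX0, hX⟩ := exists_linear_ode
    ((ContinuousLinearMap.snd ℝ H H).prod (-(B.comp (ContinuousLinearMap.fst ℝ H H))))
    (F := fun t => ((0 : H), B (c t))) (continuous_const.prodMk (B.continuous.comp hc)) T
  refine ⟨fun t => (X t).1, fun t => (X t).2, by simp [hX0], by simp [hX0], fun t => ?_,
    fun t => ?_⟩
  · refine HasDerivAt.congr_deriv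
      ((ContinuousLinearMap.fst ℝ H H).hasFDerivAt.comp_hasDerivAt t (hX t)) ?_
    simp
  · refine HasDerivAt.congr_deriv
      ((ContinuousLinearMap.snd ℝ H H).hasFDerivAt.comp_hasDerivAt t (hX t)) ?_
    simp [sub_eq_neg_add]

/-- The successive derivatives of a solution of `x'' = B (c - x)`, in terms of `x`, `v = x'` and the
successive derivatives of `c`. -/
def derivTower {H : Type*} [NormedAddCommGroup H] [NormedSpace ℝ H] (B : H →L[ℝ] H)
    (c : ℕ → ℝ → H) (x v : ℝ → H) : ℕ → ℝ → H
  | 0 => x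
  | 1 => v
  | n + 2 => fun t => B (c n t - derivTower B c x v n t)

/-- The equation may be differentiated indefinitely, and each derivative of the solution inherits
zero data at `T` because all `c n` vanish there. -/
theorem exists_smooth_second_order_ode {H : Type*} [NormedAddCommGroup H] [NormedSpace ℝ H]
    [CompleteSpace H] (B : H →L[ℝ] H) {c : ℕ → ℝ → H} {T : ℝ}
    (hc : ∀ n t, HasDerivAt (c n) (c (n + 1) t) t) (hcT : ∀ n, c n T = 0) :
    ∃ D : ℕ → ℝ → H, (∀ n t, HasDerivAt (D n) (D (n + 1) t) t) ∧ (∀ n, D n T = 0) ∧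
      ∀ n t, D (n + 2) t = B (c n t - D n t) := by
  obtain ⟨x, v, hx, hv, hdx, hdv⟩ := exists_second_order_ode B
    (c := c 0) (continuous_iff_continuousAt.2 fun t => (hc 0 t).continuousAt) T
  refine ⟨derivTower B c x v, fun n => ?_, fun n => ?_, fun n t => by rw [derivTower]⟩
  · induction n using Nat.twoStepInduction with
    | zero => exact hdx
    | one =>
      intro t
      simpa [derivTower] using hdv t
    | more n h1 _ =>
      intro t
      exact B.hasFDerivAt.comp_hasDerivAt t ((hc n t).sub (h1 t))
  · induction n using Nat.twoStepInduction with
    | zero => exact hx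
    | one => exact hv
    | more n h1 _ => simp [derivTower, h1, hcT]

/-- The energy estimate for the equation `S R x'' + x = b`. -/
theorem energy_estimate {H : Type*} [NormedAddCommGroup H] [InnerProductSpace ℝ H]
    {S R : H →L[ℝ] H} {r T τ M : ℝ} (hr : 0 < r) (hτ : 0 ≤ τ)
    (hS : ∀ x y, inner ℝ (S x) y = inner ℝ x (S y)) (hSpos : ∀ x, 0 ≤ inner ℝ (S x) x)
    (hR : ∀ x y, inner ℝ (R x) y = inner ℝ x (R y)) (hRpos : ∀ x, r * ‖x‖ ^ 2 ≤ inner ℝ (R x) x)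
    {x v w b b' : ℝ → H} (hx : ∀ t, HasDerivAt x (v t) t) (hv : ∀ t, HasDerivAt v (w t) t)
    (hb : ∀ t, HasDerivAt b (b' t) t) (heq : ∀ t, S (R (w t)) + x t = b t)
    (hxT : x T = 0) (hvT : v T = 0)
    (hM : ∀ t ∈ Icc (T - τ) (T + τ), ‖b t‖ ≤ M) (hM' : ∀ t ∈ Icc (T - τ) (T + τ), ‖b' t‖ ≤ M) :
    ∀ t ∈ Icc (T - τ) (T + τ), ‖x t‖ ≤ 2 * ‖R‖ * (1 + τ) / r * M := by
  have hTmem : T ∈ Icc (T - τ) (T + τ) := ⟨by linarith, by linarith⟩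
  have hM0 : 0 ≤ M := (norm_nonneg _).trans (hM T hTmem)
  -- At a maximum point of `‖x‖` the estimate is quadratic on the left and linear on the right in
  -- the maximum `m`, so one factor `m` cancels.
  obtain ⟨s, hs, hmax⟩ := isCompact_Icc.exists_isMaxOn ⟨T, hTmem⟩
    (f := fun t => ‖x t‖) fun t _ => (hx t).continuousAt.norm.continuousWithinAt
  set m := ‖x s‖ with hm
  have hmax' : ∀ t ∈ Icc (T - τ) (T + τ), ‖x t‖ ≤ m := fun t ht => hmax ht
  -- Since `S` is only nonnegative, the energy does not control `v`. The correction `-2 ⟨b, R x⟩`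
  -- moves the time derivative from `x` to `b`, so that `W'` involves `x` and `b'` only.
  set W : ℝ → ℝ := fun t => inner ℝ (S (R (v t))) (R (v t)) + inner ℝ (R (x t)) (x t)
    - 2 * inner ℝ (b t) (R (x t)) with hW
  have hRd : ∀ {y z : ℝ → H} {t}, HasDerivAt y (z t) t →
      HasDerivAt (fun t => R (y t)) (R (z t)) t := fun {y z t} h =>
    R.hasFDerivAt.comp_hasDerivAt t h
  have hSd : ∀ {y z : ℝ → H} {t}, HasDerivAt y (z t) t →
      HasDerivAt (fun t => S (y t)) (S (z t)) t := fun {y z t} h =>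
    S.hasFDerivAt.comp_hasDerivAt t h
  have hWd : ∀ t, HasDerivAt W (-2 * inner ℝ (b' t) (R (x t))) t := fun t => by
    have h1 := ((hSd (z := fun t => R (w t)) (hRd (hv t))).inner ℝ (hRd (hv t))).add
      ((hRd (hx t)).inner ℝ (hx t)) |>.sub (((hb t).inner ℝ (hRd (hx t))).const_mul 2)
    refine h1.congr_deriv ?_
    have h2 : S (R (w t)) = b t - x t := eq_sub_of_add_eq (heq t)
    rw [hS (R (v t)) (R (w t)), h2, hR (x t) (v t), inner_sub_left, inner_sub_right,
      real_inner_comm (R (v t)) (b t), real_inner_comm (x t) (R (v t))]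
    ring
  have hRx : ∀ t ∈ Icc (T - τ) (T + τ), ‖R (x t)‖ ≤ ‖R‖ * m := fun t ht =>
    (R.le_opNorm _).trans (mul_le_mul_of_nonneg_left (hmax' t ht) (norm_nonneg _))
  have hbound : ∀ {y : H} t, t ∈ Icc (T - τ) (T + τ) → ‖y‖ ≤ M →
      |inner ℝ y (R (x t))| ≤ M * (‖R‖ * m) := fun {y} t ht hy =>
    (abs_real_inner_le_norm _ _).trans (mul_le_mul hy (hRx t ht) (norm_nonneg _) hM0)
  have hdiff := (convex_Icc (T - τ) (T + τ)).norm_image_sub_le_of_norm_hasDerivWithin_le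
    (f := W) (C := 2 * (M * (‖R‖ * m))) (fun t _ => (hWd t).hasDerivWithinAt)
    (fun t ht => by
      rw [norm_mul, Real.norm_eq_abs, Real.norm_eq_abs]
      simpa using hbound t ht (hM' t ht)) hTmem hs
  have hWT : W T = 0 := by simp [hW, hxT, hvT]
  have hsT : ‖s - T‖ ≤ τ := by
    rw [Real.norm_eq_abs, abs_le]
    constructor <;> linarith [hs.1, hs.2]
  have hC0 : 0 ≤ M * (‖R‖ * m) := by positivity
  have h1 : W s ≤ 2 * (M * (‖R‖ * m)) * τ := by
    rw [hWT, sub_zero] at hdiff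
    exact (le_abs_self _).trans (hdiff.trans (mul_le_mul_of_nonneg_left hsT (by positivity)))
  have h2 : inner ℝ (b s) (R (x s)) ≤ M * (‖R‖ * m) :=
    (le_abs_self _).trans (hbound s hs (hM s hs))
  have h3 : r * m ^ 2 ≤ 2 * (M * (‖R‖ * m)) * (1 + τ) := by
    have := hRpos (x s)
    have := hSpos (R (v s))
    simp only [hW] at h1
    nlinarith
  intro t ht
  refine (hmax' t ht).trans ?_
  rcases (norm_nonneg (x s)).eq_or_lt with h0 | h0
  · rw [hm, ← h0]; positivity
  · rw [div_mul_eq_mul_div, le_div_iff₀ hr]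
    refine le_of_mul_le_mul_right (a := m) ?_ h0
    calc m * r * m = r * m ^ 2 := by ring
      _ ≤ _ := h3
      _ = _ := by ring

/-- Solvability of `S R x'' + x = c` with zero final data at `T`, for a smooth right-hand side `c 0`
(with the successive derivatives `c n`) that vanishes to infinite order at `T`: the solution is the
limit of the solutions with `S` replaced by `S + 1 / (k + 1)`. -/
theorem exists_evolution {H : Type*} [NormedAddCommGroup H] [InnerProductSpace ℝ H]
    [CompleteSpace H] {S R : H →L[ℝ] H} {r T τ : ℝ} (hr : 0 < r) (hτ : 0 ≤ τ)
    (hS : ∀ x y, inner ℝ (S x) y = inner ℝ x (S y)) (hSpos : ∀ x, 0 ≤ inner ℝ (S x) x)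
    (hR : ∀ x y, inner ℝ (R x) y = inner ℝ x (R y)) (hRpos : ∀ x, r * ‖x‖ ^ 2 ≤ inner ℝ (R x) x)
    {c : ℕ → ℝ → H} (hc : ∀ n t, HasDerivAt (c n) (c (n + 1) t) t) (hcT : ∀ n, c n T = 0) :
    ∃ D : ℕ → ℝ → H, (∀ n, D n T = 0) ∧
      (∀ n, ∀ t ∈ Ioo (T - τ) (T + τ), HasDerivAt (D n) (D (n + 1) t) t) ∧
      ∀ n, ∀ t ∈ Icc (T - τ) (T + τ), S (R (D (n + 2) t)) + D n t = c n t := by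
  set I := Icc (T - τ) (T + τ) with hI
  have hTmem : T ∈ I := ⟨by linarith, by linarith⟩
  set e : ℕ → ℝ := fun k => 1 / ((k : ℝ) + 1) with he
  have hepos : ∀ k, 0 < e k := fun k => by positivity
  have hetend : Tendsto e atTop (𝓝 0) := tendsto_one_div_add_atTop_nhds_zero_nat
  set Sk : ℕ → H →L[ℝ] H := fun k => S + e k • ContinuousLinearMap.id ℝ H with hSk
  have hSk_apply : ∀ k x, Sk k x = S x + e k • x := fun k x => by simp [hSk]
  have hSk_symm : ∀ k x y, inner ℝ (Sk k x) y = inner ℝ x (Sk k y) := fun k x y => by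
    rw [hSk_apply, hSk_apply, inner_add_left, inner_add_right, hS, real_inner_smul_left,
      real_inner_smul_right]
  have hSk_coer : ∀ k x, e k * ‖x‖ ^ 2 ≤ inner ℝ (Sk k x) x := fun k x => by
    rw [hSk_apply, inner_add_left, real_inner_smul_left, real_inner_self_eq_norm_sq]
    linarith [hSpos x]
  have hSk_pos : ∀ k x, 0 ≤ inner ℝ (Sk k x) x := fun k x =>
    (mul_nonneg (hepos k).le (sq_nonneg _)).trans (hSk_coer k x)
  obtain ⟨R', hR'⟩ := exists_rightInverse_of_coercive hr hRpos
  have hex : ∀ k, ∃ D : ℕ → ℝ → H, (∀ n t, HasDerivAt (D n) (D (n + 1) t) t) ∧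
      (∀ n, D n T = 0) ∧ ∀ n t, Sk k (R (D (n + 2) t)) + D n t = c n t := fun k => by
    obtain ⟨B, hB⟩ := exists_rightInverse_of_coercive (hepos k) (hSk_coer k)
    obtain ⟨D, h1, h2, h3⟩ := exists_smooth_second_order_ode (R'.comp B) hc hcT
    exact ⟨D, h1, h2, fun n t => by simp [h3, hR', hB]⟩
  choose D hD hDT hDeq using hex
  have hbd : ∀ n, ∃ M, ∀ t ∈ I, ‖c n t‖ ≤ M := fun n =>
    isCompact_Icc.exists_bound_of_continuousOn fun t _ => (hc n t).continuousAt.continuousWithinAt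
  choose M hM using hbd
  set C := 2 * ‖R‖ * (1 + τ) / r with hC
  have hC0 : 0 ≤ C := by positivity
  -- The energy estimate uses no coercivity of `Sk k`, so its constant does not depend on `k`.
  have hunif : ∀ n, ∃ N, ∀ k, ∀ t ∈ I, ‖D k n t‖ ≤ N := fun n =>
    ⟨C * max (M n) (M (n + 1)), fun k => energy_estimate hr hτ (hSk_symm k) (hSk_pos k) hR hRpos
      (hD k n) (hD k (n + 1)) (hc n) (hDeq k n) (hDT k n) (hDT k (n + 1))
      (fun t ht => (hM n t ht).trans (le_max_left _ _))
      fun t ht => (hM (n + 1) t ht).trans (le_max_right _ _)⟩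
  choose N hN using hunif
  -- The difference of two approximations solves the `k`-th equation with right-hand side `(e l - e
  -- k) R (D l (n + 2))`. Its estimate consumes the derivatives of orders `n + 2` and `n + 3`, which
  -- is why the whole tower of derivatives is carried along.
  have hcauchy_bd : ∀ n, ∃ K, 0 ≤ K ∧ ∀ k l, ∀ t ∈ I, ‖D k n t - D l n t‖ ≤ K * |e l - e k| :=
      fun n => by
    have hK0 : 0 ≤ max (N (n + 2)) (N (n + 3)) :=
      (norm_nonneg _).trans ((hN (n + 2) 0 T hTmem).trans (le_max_left _ _))
    have hrhs : ∀ k l j, j = n + 2 ∨ j = n + 3 → ∀ t ∈ I, ‖(e l - e k) • R (D l j t)‖ ≤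
        |e l - e k| * (‖R‖ * max (N (n + 2)) (N (n + 3))) := fun k l j hj t ht => by
      rw [norm_smul, Real.norm_eq_abs]
      refine mul_le_mul_of_nonneg_left ((R.le_opNorm _).trans
        (mul_le_mul_of_nonneg_left ?_ (norm_nonneg _))) (abs_nonneg _)
      rcases hj with rfl | rfl
      · exact (hN _ l t ht).trans (le_max_left _ _)
      · exact (hN _ l t ht).trans (le_max_right _ _)
    refine ⟨C * (‖R‖ * max (N (n + 2)) (N (n + 3))), by positivity, fun k l t ht => ?_⟩
    refine (energy_estimate (x := fun t => D k n t - D l n t)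
      (v := fun t => D k (n + 1) t - D l (n + 1) t) (w := fun t => D k (n + 2) t - D l (n + 2) t)
      (b := fun t => (e l - e k) • R (D l (n + 2) t))
      (b' := fun t => (e l - e k) • R (D l (n + 3) t)) hr hτ (hSk_symm k) (hSk_pos k) hR hRpos
      (fun t => (hD k n t).sub (hD l n t)) (fun t => (hD k (n + 1) t).sub (hD l (n + 1) t))
      (fun t => (R.hasFDerivAt.comp_hasDerivAt t (hD l (n + 2) t)).const_smul _) (fun t => ?_)
      (by simp [hDT]) (by simp [hDT]) (hrhs k l _ (Or.inl rfl)) (hrhs k l _ (Or.inr rfl))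
      t ht).trans_eq (by ring)
    have h1 := hDeq k n t
    have h2 := hDeq l n t
    rw [hSk_apply] at h1 h2
    rw [hSk_apply, map_sub, map_sub, smul_sub, sub_smul]
    have h3 := h1.trans h2.symm
    have h4 : S (R (D k (n + 2) t)) = S (R (D l (n + 2) t)) + e l • R (D l (n + 2) t) + D l n t
        - D k n t - e k • R (D k (n + 2) t) := by
      rw [← h3]; abel
    rw [h4]
    abel
  have hcauchy : ∀ n, UniformCauchySeqOn (fun k => D k n) atTop I := fun n => by
    obtain ⟨K, hK0, hK⟩ := hcauchy_bd n
    rw [Metric.uniformCauchySeqOn_iff]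
    intro ε hε
    obtain ⟨N₀, hN₀⟩ := Metric.cauchySeq_iff.1 hetend.cauchySeq (ε / (K + 1)) (by positivity)
    refine ⟨N₀, fun k hk l hl t ht => ?_⟩
    have h1 := hN₀ l hl k hk
    rw [Real.dist_eq, lt_div_iff₀ (by positivity)] at h1
    rw [dist_eq_norm]
    refine (hK k l t ht).trans_lt (lt_of_le_of_lt ?_ h1)
    nlinarith [abs_nonneg (e l - e k)]
  have hlim : ∀ n t, ∃ y, t ∈ I → Tendsto (fun k => D k n t) atTop (𝓝 y) := fun n t => by
    by_cases ht : t ∈ I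
    · obtain ⟨y, hy⟩ := cauchySeq_tendsto_of_complete ((hcauchy n).cauchySeq ht)
      exact ⟨y, fun _ => hy⟩
    · exact ⟨0, fun h => absurd h ht⟩
  choose Y hY using hlim
  have hYunif : ∀ n, TendstoUniformlyOn (fun k => D k n) (Y n) atTop I := fun n =>
    (hcauchy n).tendstoUniformlyOn_of_tendsto fun t ht => hY n t ht
  refine ⟨Y, fun n => ?_, fun n t ht => ?_, fun n t ht => ?_⟩
  · refine tendsto_nhds_unique (hY n T hTmem) ?_
    simp [hDT]
  · exact hasDerivAt_of_tendstoUniformlyOn isOpen_Ioo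
      ((hYunif (n + 1)).mono Ioo_subset_Icc_self)
      (Eventually.of_forall fun k s _ => hD k n s)
      (fun s hs => hY n s (Ioo_subset_Icc_self hs)) ht
  · have hR2 : Tendsto (fun k => R (D k (n + 2) t)) atTop (𝓝 (R (Y (n + 2) t))) :=
      (R.continuous.tendsto _).comp (hY (n + 2) t ht)
    have h1 : Tendsto (fun k => Sk k (R (D k (n + 2) t)) + D k n t) atTop
        (𝓝 (S (R (Y (n + 2) t)) + (0 : ℝ) • R (Y (n + 2) t) + Y n t)) := by
      simp only [hSk_apply]
      exact (((S.continuous.tendsto _).comp hR2).add (hetend.smul hR2)).add (hY n t ht)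
    simp only [hDeq] at h1
    simpa using (tendsto_nhds_unique h1 tendsto_const_nhds)

/-! ### The coefficients as symmetric coercive operators. -/

theorem inner_mulOp_comm {L : ℝ} {m : ℝ → ℝ} {M : L2 L →L[ℝ] L2 L}
    (hM : ∀ g : L2 L, ∀ᵐ x ∂(volume.restrict (Ioo 0 L)), M g x = m x * g x) (f g : L2 L) :
    inner ℝ (M f) g = inner ℝ f (M g) := by
  rw [inner_eq_setIntegral, inner_eq_setIntegral]
  refine integral_congr_ae ?_
  filter_upwards [hM f, hM g] with x h1 h2
  rw [h1, h2]
  ring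

theorem le_inner_mulOp_self {L c : ℝ} {m : ℝ → ℝ} {M : L2 L →L[ℝ] L2 L}
    (hM : ∀ g : L2 L, ∀ᵐ x ∂(volume.restrict (Ioo 0 L)), M g x = m x * g x)
    (hc : ∀ᵐ x ∂(volume.restrict (Ioo 0 L)), c ≤ m x) (g : L2 L) :
    c * ‖g‖ ^ 2 ≤ inner ℝ (M g) g := by
  rw [← real_inner_self_eq_norm_sq, ← real_inner_smul_left, L2.inner_def, L2.inner_def]
  refine integral_mono_ae (L2.integrable_inner _ _) (L2.integrable_inner _ _) ?_
  filter_upwards [hM g, hc, Lp.coeFn_smul c g] with x h1 h2 h3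
  simp only [h1, h3, Pi.smul_apply, smul_eq_mul, RCLike.inner_apply, conj_trivial]
  nlinarith [mul_self_nonneg (g x)]

theorem intervalIntegrable_clm_comp {E F : Type*} [NormedAddCommGroup E] [NormedSpace ℝ E]
    [NormedAddCommGroup F] [NormedSpace ℝ F] (Λ : E →L[ℝ] F) {f : ℝ → E} {x y : ℝ}
    (h : IntervalIntegrable f volume x y) : IntervalIntegrable (fun t => Λ (f t)) volume x y :=
  ⟨Λ.integrable_comp h.1, Λ.integrable_comp h.2⟩

/-- The operators on `L²(0, L)` associated with the coefficients `ρ` and `a`: integration from `0`,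
multiplication by `ρ`, and multiplication by `1 / a`. -/
structure WaveOperators (L : ℝ) (ρ a : ℝ → ℝ) where
  P : L2 L →L[ℝ] L2 L
  R : L2 L →L[ℝ] L2 L
  A : L2 L →L[ℝ] L2 L
  r : ℝ
  α : ℝ
  δ : ℝ
  L_pos : 0 < L
  r_pos : 0 < r
  α_pos : 0 < α
  δ_pos : 0 < δ
  le_a : ∀ᵐ x ∂(volume.restrict (Ioo 0 L)), δ ≤ a x
  P_ae : ∀ g : L2 L, ∀ᵐ x ∂(volume.restrict (Ioo 0 L)), P g x = ∫ ξ in (0 : ℝ)..x, g ξ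
  R_ae : ∀ g : L2 L, ∀ᵐ x ∂(volume.restrict (Ioo 0 L)), R g x = ρ x * g x
  A_ae : ∀ g : L2 L, ∀ᵐ x ∂(volume.restrict (Ioo 0 L)), A g x = (a x)⁻¹ * g x
  le_inner_R : ∀ g, r * ‖g‖ ^ 2 ≤ inner ℝ (R g) g
  le_inner_A : ∀ g, α * ‖g‖ ^ 2 ≤ inner ℝ (A g) g

theorem nonempty_waveOperators {L : ℝ} (hL : 0 < L) {ρ a : ℝ → ℝ} {ρ₀ ρ₁ a₀ a₁ : ℝ}
    (hρ₀ : 0 < ρ₀) (ha₀ : 0 < a₀)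
    (hρ : ∀ᵐ x ∂(volume.restrict (Ioo 0 L)), ρ₀ ≤ ρ x ∧ ρ x ≤ ρ₁)
    (ha : ∀ᵐ x ∂(volume.restrict (Ioo 0 L)), a₀ ≤ a x ∧ a x ≤ a₁)
    (hρm : AEMeasurable ρ (volume.restrict (Ioo 0 L)))
    (ham : AEMeasurable a (volume.restrict (Ioo 0 L))) : Nonempty (WaveOperators L ρ a) := by
  obtain ⟨P, hP⟩ := exists_volterra L
  obtain ⟨R, hR⟩ := exists_mulOp (C := ρ₁) hρm.aestronglyMeasurable (by
    filter_upwards [hρ] with x hx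
    rw [abs_of_pos (hρ₀.trans_le hx.1)]
    exact hx.2)
  obtain ⟨A, hA⟩ := exists_mulOp (C := a₀⁻¹) ham.inv.aestronglyMeasurable (by
    filter_upwards [ha] with x hx
    rw [Pi.inv_apply, abs_of_pos (inv_pos.2 (ha₀.trans_le hx.1))]
    exact inv_anti₀ ha₀ hx.1)
  have : (ae (volume.restrict (Ioo 0 L))).NeBot := by
    rw [ae_neBot, Ne, Measure.restrict_eq_zero, Real.volume_Ioo]
    simpa using hL
  obtain ⟨x₀, hx₀⟩ := ha.exists
  have ha₁ : 0 < a₁ := ha₀.trans_le (hx₀.1.trans hx₀.2)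
  exact ⟨{
    P := P, R := R, A := A, r := ρ₀, α := a₁⁻¹, δ := a₀
    L_pos := hL, r_pos := hρ₀, α_pos := inv_pos.2 ha₁, δ_pos := ha₀
    le_a := ha.mono fun x hx => hx.1
    P_ae := hP, R_ae := hR, A_ae := hA
    le_inner_R := le_inner_mulOp_self hR (hρ.mono fun x hx => hx.1)
    le_inner_A := le_inner_mulOp_self hA (by
      filter_upwards [ha] with x hx
      exact inv_anti₀ (ha₀.trans_le hx.1) hx.2) }⟩

/-! ### The Green operator of `-(a w')'` and its boundary fluxes. -/

namespace WaveOperators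

variable {L : ℝ} {ρ a : ℝ → ℝ} (W : WaveOperators L ρ a)

theorem inner_R_comm (f g : L2 L) : inner ℝ (W.R f) g = inner ℝ f (W.R g) :=
  inner_mulOp_comm W.R_ae f g

theorem inner_A_comm (f g : L2 L) : inner ℝ (W.A f) g = inner ℝ f (W.A g) :=
  inner_mulOp_comm W.A_ae f g

/-- The adjoint of the Volterra operator, `g ↦ ∫ₓᴸ g`. -/
noncomputable def Pt : L2 L →L[ℝ] L2 L := (innerSL ℝ (one L)).smulRight (one L) - W.P

theorem Pt_apply (g : L2 L) : W.Pt g = inner ℝ (one L) g • one L - W.P g := by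
  simp [Pt]

theorem inner_Pt (f g : L2 L) : inner ℝ (W.Pt f) g = inner ℝ f (W.P g) := by
  rw [Pt_apply, inner_sub_left, real_inner_smul_left]
  linarith [inner_volterra_add W.L_pos W.P_ae f g]

/-- The constant `(∫₀ᴸ 1 / a)⁻¹`. -/
noncomputable def κ : ℝ := (inner ℝ (W.A (one L)) (one L))⁻¹

theorem inner_A_one_pos : 0 < inner ℝ (W.A (one L)) (one L) := by
  refine lt_of_lt_of_le (mul_pos W.α_pos (pow_pos (norm_pos_iff.2 fun h => ?_) 2))
    (W.le_inner_A _)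
  have h1 := inner_one_left W.L_pos (one L)
  have h2 : ∫ x in (0 : ℝ)..L, one L x = L := by
    rw [intervalIntegral.integral_of_le W.L_pos.le,
      ← setIntegral_congr_set (Ioo_ae_eq_Ioc (μ := volume)), integral_congr_ae (coeFn_one L)]
    simp [W.L_pos.le]
  rw [h2, h, inner_zero_left] at h1
  exact W.L_pos.ne h1

theorem κ_mul_inner : W.κ * inner ℝ (W.A (one L)) (one L) = 1 :=
  inv_mul_cancel₀ W.inner_A_one_pos.ne'

/-- Minus the flux `a w'` at `L` of the solution `w ∈ H¹₀(0, L)` of `-(a w')' = g`. -/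
noncomputable def fluxRight : L2 L →L[ℝ] ℝ := W.κ • (innerSL ℝ (W.A (one L))).comp W.Pt

/-- The flux `a w'` at `0` of the solution `w ∈ H¹₀(0, L)` of `-(a w')' = g`. -/
noncomputable def fluxLeft : L2 L →L[ℝ] ℝ := innerSL ℝ (one L) - W.fluxRight

/-- The flux `a w'` of the solution `w ∈ H¹₀(0, L)` of `-(a w')' = g`. -/
noncomputable def flux : L2 L →L[ℝ] L2 L := W.Pt - W.fluxRight.smulRight (one L)

/-- The derivative of the solution `w ∈ H¹₀(0, L)` of `-(a w')' = g`. -/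
noncomputable def slope : L2 L →L[ℝ] L2 L := W.A.comp W.flux

/-- The solution operator `g ↦ w ∈ H¹₀(0, L)` of `-(a w')' = g`. -/
noncomputable def S : L2 L →L[ℝ] L2 L := W.P.comp W.slope

/-- The solution of `(a w')' = 0`, `w(0) = 0`, `w(L) = 1`. -/
noncomputable def lift : L2 L := W.κ • W.P (W.A (one L))

theorem fluxRight_apply (g : L2 L) : W.fluxRight g = W.κ * inner ℝ (W.A (one L)) (W.Pt g) := by
  simp [fluxRight]

/-- Green's identity between `S g` and the lift, obtained by moving `Pt` across the inner product.
-/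
theorem fluxRight_eq_inner_lift (g : L2 L) : W.fluxRight g = inner ℝ W.lift g := by
  rw [fluxRight_apply, lift, real_inner_smul_left, real_inner_comm, inner_Pt, real_inner_comm]

theorem fluxLeft_eq_inner (g : L2 L) : W.fluxLeft g = inner ℝ (one L - W.lift) g := by
  rw [inner_sub_left, ← fluxRight_eq_inner_lift]
  simp [fluxLeft]

theorem flux_apply (g : L2 L) : W.flux g = W.Pt g - W.fluxRight g • one L := by
  simp [flux]

/-- This is the condition `w(L) = 0`; the value of `κ` is chosen for it. -/
theorem inner_one_slope (g : L2 L) : inner ℝ (one L) (W.slope g) = 0 := by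
  rw [slope, ContinuousLinearMap.comp_apply, ← inner_A_comm, flux_apply, inner_sub_right,
    real_inner_smul_right, fluxRight_apply]
  linear_combination -(inner ℝ (W.A (one L)) (W.Pt g)) * W.κ_mul_inner

theorem inner_S (f g : L2 L) : inner ℝ (W.S f) g =
    inner ℝ (W.A (W.Pt f)) (W.Pt g) -
      W.κ * inner ℝ (W.A (one L)) (W.Pt f) * inner ℝ (W.A (one L)) (W.Pt g) := by
  rw [S, ContinuousLinearMap.comp_apply, real_inner_comm, ← inner_Pt, real_inner_comm, slope,
    ContinuousLinearMap.comp_apply, flux_apply, map_sub, map_smul, inner_sub_left,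
    real_inner_smul_left, fluxRight_apply]

theorem inner_S_comm (f g : L2 L) : inner ℝ (W.S f) g = inner ℝ f (W.S g) := by
  rw [real_inner_comm (W.S g), inner_S, inner_S, inner_A_comm, real_inner_comm]
  ring

/-- The form of `S` at `g` is the form of `A` at `Pt g` minus its `A`-orthogonal projection on the
constants. -/
theorem inner_S_nonneg (g : L2 L) : 0 ≤ inner ℝ (W.S g) g := by
  set h := W.Pt g with hh
  set c := W.κ * inner ℝ (W.A (one L)) h with hc
  have h1 : 0 ≤ inner ℝ (W.A (h - c • one L)) (h - c • one L) :=
    (mul_nonneg W.α_pos.le (sq_nonneg _)).trans (W.le_inner_A _)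
  rw [map_sub, map_smul, inner_sub_left, inner_sub_right, inner_sub_right, real_inner_smul_left,
    real_inner_smul_left, real_inner_smul_right, real_inner_smul_right, inner_A_comm W h (one L),
    real_inner_comm (W.A (one L)) h] at h1
  rw [inner_S, ← hh, ← hc]
  have h2 : c * inner ℝ (W.A (one L)) (one L) = inner ℝ (W.A (one L)) h := by
    rw [hc]
    linear_combination (inner ℝ (W.A (one L)) h) * W.κ_mul_inner
  rw [h2] at h1
  linarith

/-- The flux has a continuous representative, so the slope has one-sided limits at the ends as soon
as `a` does. -/
theorem flux_ae (g : L2 L) : ∀ᵐ x ∂(volume.restrict (Ioo 0 L)),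
    W.flux g x = W.fluxLeft g - ∫ ξ in (0 : ℝ)..x, g ξ := by
  have h : W.flux g = W.fluxLeft g • one L - W.P g := by
    rw [flux_apply, Pt_apply]
    simp only [fluxLeft, sub_apply, innerSL_apply_apply, sub_smul]
    abel
  rw [h]
  filter_upwards [Lp.coeFn_sub (W.fluxLeft g • one L) (W.P g),
    Lp.coeFn_smul (W.fluxLeft g) (one L), coeFn_one L, W.P_ae g] with x h1 h2 h3 h4
  rw [h1, Pi.sub_apply, h2, Pi.smul_apply, h3, h4]
  simp

theorem slope_ae (g : L2 L) : ∀ᵐ x ∂(volume.restrict (Ioo 0 L)),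
    W.slope g x = (a x)⁻¹ * (W.fluxLeft g - ∫ ξ in (0 : ℝ)..x, g ξ) := by
  filter_upwards [W.A_ae (W.flux g), W.flux_ae g] with x h1 h2
  rw [slope, ContinuousLinearMap.comp_apply, h1, h2]

theorem A_one_ae : ∀ᵐ x ∂(volume.restrict (Ioo 0 L)), W.A (one L) x = (a x)⁻¹ := by
  filter_upwards [W.A_ae (one L), coeFn_one L] with x h1 h2
  rw [h1, h2, mul_one]

theorem pos_of_tendsto_zero (W : WaveOperators L ρ a) {l : ℝ} (h : Tendsto a (𝓝[>] 0) (𝓝 l)) : 0 < l := by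
  have := neBot_inf_ae_zero
  exact W.δ_pos.trans_le (ge_of_tendsto (h.mono_left inf_le_left)
    (eventually_inf_ae_of_ae_restrict (Ioo_mem_nhdsGT W.L_pos) W.le_a))

theorem pos_of_tendsto_right (W : WaveOperators L ρ a) {l : ℝ} (h : Tendsto a (𝓝[<] L) (𝓝 l)) : 0 < l := by
  have := neBot_inf_ae_left L
  exact W.δ_pos.trans_le (ge_of_tendsto (h.mono_left inf_le_left)
    (eventually_inf_ae_of_ae_restrict (Ioo_mem_nhdsLT W.L_pos) W.le_a))

/-- The one-sided limit at `0` of the derivative of a solution of `-(a w')' = g`. -/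
theorem tendsto_slope_zero {l : ℝ} (h : Tendsto a (𝓝[>] 0) (𝓝 l)) (g : L2 L) (k : ℝ) :
    Tendsto (W.slope g + k • W.A (one L) : L2 L) (𝓝[>] 0 ⊓ ae volume)
      (𝓝 (l⁻¹ * (W.fluxLeft g + k))) := by
  have hc : Tendsto (fun x => ∫ ξ in (0 : ℝ)..x, g ξ) (𝓝[>] 0) (𝓝 0) := by
    have h1 := (L2.continuousOn_primitive g) 0 (left_mem_Icc.2 W.L_pos.le)
    rw [ContinuousWithinAt, intervalIntegral.integral_same] at h1
    refine h1.mono_left ?_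
    rw [← nhdsWithin_Ioo_eq_nhdsGT W.L_pos]
    exact nhdsWithin_mono _ Ioo_subset_Icc_self
  have h2 : Tendsto (fun x => (a x)⁻¹ * (W.fluxLeft g - (∫ ξ in (0 : ℝ)..x, g ξ) + k)) (𝓝[>] 0)
      (𝓝 (l⁻¹ * (W.fluxLeft g - 0 + k))) :=
    (h.inv₀ (W.pos_of_tendsto_zero h).ne').mul ((tendsto_const_nhds.sub hc).add tendsto_const_nhds)
  rw [sub_zero] at h2
  refine (h2.mono_left inf_le_left).congr' ?_
  refine eventually_inf_ae_of_ae_restrict (Ioo_mem_nhdsGT W.L_pos) ?_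
  filter_upwards [W.slope_ae g, W.A_one_ae, Lp.coeFn_add (W.slope g) (k • W.A (one L)),
    Lp.coeFn_smul k (W.A (one L))] with x h1 h2 h3 h4
  rw [h3, Pi.add_apply, h4, Pi.smul_apply, h1, h2, smul_eq_mul]
  ring

/-- The one-sided limit at `L` of the derivative of a solution of `-(a w')' = g`. -/
theorem tendsto_slope_right {l : ℝ} (h : Tendsto a (𝓝[<] L) (𝓝 l)) (g : L2 L) (k : ℝ) :
    Tendsto (W.slope g + k • W.A (one L) : L2 L) (𝓝[<] L ⊓ ae volume)
      (𝓝 (l⁻¹ * (k - W.fluxRight g))) := by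
  have hc : Tendsto (fun x => ∫ ξ in (0 : ℝ)..x, g ξ) (𝓝[<] L) (𝓝 (inner ℝ (one L) g)) := by
    have h1 := (L2.continuousOn_primitive g) L (right_mem_Icc.2 W.L_pos.le)
    rw [ContinuousWithinAt, ← inner_one_left W.L_pos] at h1
    refine h1.mono_left ?_
    rw [← nhdsWithin_Ioo_eq_nhdsLT W.L_pos]
    exact nhdsWithin_mono _ Ioo_subset_Icc_self
  have h2 : Tendsto (fun x => (a x)⁻¹ * (W.fluxLeft g - (∫ ξ in (0 : ℝ)..x, g ξ) + k)) (𝓝[<] L)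
      (𝓝 (l⁻¹ * (W.fluxLeft g - inner ℝ (one L) g + k))) :=
    (h.inv₀ (W.pos_of_tendsto_right h).ne').mul ((tendsto_const_nhds.sub hc).add tendsto_const_nhds)
  have h3 : W.fluxLeft g - inner ℝ (one L) g + k = k - W.fluxRight g := by
    simp only [fluxLeft, sub_apply, innerSL_apply_apply]
    ring
  rw [h3] at h2
  refine (h2.mono_left inf_le_left).congr' ?_
  refine eventually_inf_ae_of_ae_restrict (Ioo_mem_nhdsLT W.L_pos) ?_
  filter_upwards [W.slope_ae g, W.A_one_ae, Lp.coeFn_add (W.slope g) (k • W.A (one L)),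
    Lp.coeFn_smul k (W.A (one L))] with x h1 h2 h3 h4
  rw [h3, Pi.add_apply, h4, Pi.smul_apply, h1, h2, smul_eq_mul]
  ring

theorem hasWeakDeriv (k : ℝ) (z : L2 L) : HasWeakDeriv (k • one L + W.P z) z := by
  refine ⟨k, ?_⟩
  filter_upwards [Lp.coeFn_add (k • one L) (W.P z), Lp.coeFn_smul k (one L), coeFn_one L,
    W.P_ae z] with x h1 h2 h3 h4
  rw [h1, Pi.add_apply, h2, Pi.smul_apply, h3, h4, smul_eq_mul, mul_one]

/-- Displays the weak derivative, the lift having slope `κ / a`. -/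
theorem S_add_smul_lift (g : L2 L) (k : ℝ) :
    W.S g + k • W.lift = W.P (W.slope g + (k * W.κ) • W.A (one L)) := by
  rw [map_add, map_smul, lift, smul_smul]
  rfl

/-! ### From the operator equation to weak solutions and traces. -/

/-- A function of `H¹₀(0, L)` is the integral of an element of `L²(0, L)` with zero mean. -/
theorem exists_of_isH10 {v dv : ℝ → ℝ} (h : IsH10 L v dv) :
    ∃ d : L2 L, (∀ᵐ x ∂(volume.restrict (Ioo 0 L)), d x = dv x) ∧
      (∀ᵐ x ∂(volume.restrict (Ioo 0 L)), W.P d x = v x) ∧ inner ℝ (one L) d = 0 := by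
  obtain ⟨⟨hdv, hv⟩, hv0, hvL⟩ := h
  have hd := hdv.coeFn_toLp
  have hint : ∀ x ∈ Icc 0 L, ∫ ξ in (0 : ℝ)..x, hdv.toLp dv ξ = v x := fun x hx => by
    rw [hv x hx, hv0, zero_add]
    refine intervalIntegral.integral_congr_ae ?_
    have h0 : ∀ᵐ y ∂(volume : Measure ℝ), y ≠ L := by simp [ae_iff]
    rw [EventuallyEq, ae_restrict_iff' measurableSet_Ioo] at hd
    filter_upwards [hd, h0] with y hy hyL hyx
    rw [uIoc_of_le hx.1] at hyx
    exact hy ⟨hyx.1, lt_of_le_of_ne (hyx.2.trans hx.2) hyL⟩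
  refine ⟨hdv.toLp dv, hd, ?_, ?_⟩
  · filter_upwards [W.P_ae (hdv.toLp dv), ae_restrict_mem measurableSet_Ioo] with x h1 h2
    rw [h1, hint x ⟨h2.1.le, h2.2.le⟩]
  · rw [inner_one_left W.L_pos, hint L (right_mem_Icc.2 W.L_pos.le), hvL]

/-- A twice differentiable function with `θ(t) = S (f(t) - ρ θ''(t)) + s(t) ℓ` is a finite-energy
solution of the backward problem with the source `f` and the boundary datum `s`, and its trace at
`x = 0` is explicit. -/
theorem isFiniteEnergySolution_of_eq {T : ℝ} {f θ θ' θ'' : ℝ → L2 L} {s : ℝ → ℝ}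
    (hf : ContinuousOn f (Icc 0 T)) (hs : ContinuousOn s (Icc 0 T))
    (hθ : ∀ t ∈ Icc 0 T, HasDerivWithinAt θ (θ' t) (Icc 0 T) t)
    (hθ' : ∀ t ∈ Icc 0 T, HasDerivWithinAt θ' (θ'' t) (Icc 0 T) t)
    (hθ'' : ContinuousOn θ'' (Icc 0 T)) (hT : θ T = 0) (hT' : θ' T = 0)
    (heq : ∀ t ∈ Icc 0 T, θ t = W.S (f t - W.R (θ'' t)) + s t • W.lift) :
    IsFiniteEnergySolution T ρ a f s θ := by
  have hg : ContinuousOn (fun t => f t - W.R (θ'' t)) (Icc 0 T) :=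
    hf.sub (W.R.continuous.comp_continuousOn hθ'')
  refine ⟨fun t => W.slope (f t - W.R (θ'' t)) + (s t * W.κ) • W.A (one L), θ',
    fun t ht => (hθ t ht).continuousWithinAt,
    (W.slope.continuous.comp_continuousOn hg).add ((hs.mul continuousOn_const).smul
      continuousOn_const), fun t ht => (hθ' t ht).continuousWithinAt, fun t ht => ⟨?_, ?_⟩, hθ, hT,
    hT', fun v dv hv t ht => ?_⟩
  · rw [heq t ht, S_add_smul_lift]
    exact W.P_ae _
  · rw [← inner_one_left W.L_pos, inner_add_right, inner_one_slope, real_inner_smul_right,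
      ← inner_A_comm, mul_assoc, κ_mul_inner]
    ring
  · obtain ⟨d, hd, hPd, hd1⟩ := W.exists_of_isH10 hv
    have h1 : ∀ τ, ∫ x in Ioo 0 L, ρ x * θ' τ x * v x = inner ℝ (W.R (θ' τ)) (W.P d) := fun τ => by
      rw [inner_eq_setIntegral]
      refine integral_congr_ae ?_
      filter_upwards [W.R_ae (θ' τ), hPd] with x h2 h3
      rw [h2, h3]
    have h2 : ∫ x in Ioo 0 L, f t x * v x = inner ℝ (f t) (W.P d) := by
      rw [inner_eq_setIntegral]
      refine integral_congr_ae ?_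
      filter_upwards [hPd] with x h3
      rw [h3]
    have h3 : ∫ x in Ioo 0 L, a x *
        (W.slope (f t - W.R (θ'' t)) + (s t * W.κ) • W.A (one L) : L2 L) x * dv x =
        inner ℝ (W.flux (f t - W.R (θ'' t)) + (s t * W.κ) • one L) d := by
      rw [inner_eq_setIntegral]
      refine integral_congr_ae ?_
      rw [slope, ContinuousLinearMap.comp_apply, ← map_smul, ← map_add]
      filter_upwards [W.A_ae (W.flux (f t - W.R (θ'' t)) + (s t * W.κ) • one L), hd, W.le_a]
        with x h4 h5 h6
      rw [h4, h5, mul_inv_cancel_left₀ (W.δ_pos.trans_le h6).ne']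
    simp only [h1]
    rw [h2, h3]
    have h4 := (W.R.hasFDerivAt.comp_hasDerivWithinAt t (hθ' t ht)).inner ℝ
      (hasDerivWithinAt_const t (Icc 0 T) (W.P d))
    refine h4.congr_deriv ?_
    -- The flux is `Pt` of its argument up to constants; the zero mean of `d` removes the constants,
    -- and `Pt` passes to `P d`, which is the test function.
    rw [inner_zero_right, zero_add, inner_add_left, real_inner_smul_left, hd1, flux_apply,
      inner_sub_left, real_inner_smul_left, hd1, inner_Pt, inner_sub_left]
    ring

/-- Averaging against `φ` commutes with the bounded operators, so the average solves a single
elliptic problem whose slope at `0` is known. -/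
theorem hasDxTraceZero_of_eq {T l : ℝ} (hT : 0 ≤ T) (hl : Tendsto a (𝓝[>] 0) (𝓝 l))
    {g θ : ℝ → L2 L} {s : ℝ → ℝ} (hg : ContinuousOn g (Icc 0 T)) (hs : ContinuousOn s (Icc 0 T))
    (heq : ∀ t ∈ Icc 0 T, θ t = W.S (g t) + s t • W.lift) :
    HasDxTraceZero T θ fun t => l⁻¹ * (W.fluxLeft (g t) + s t * W.κ) := by
  have hc : ContinuousOn (fun t => l⁻¹ * (W.fluxLeft (g t) + s t * W.κ)) (Icc 0 T) :=
    continuousOn_const.mul ((W.fluxLeft.continuous.comp_continuousOn hg).add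
      (hs.mul continuousOn_const))
  refine ⟨?_, fun φ hφ => ?_⟩
  · obtain ⟨C, hC⟩ := isCompact_Icc.exists_bound_of_continuousOn hc
    refine MemLp.of_bound ((hc.mono Ioo_subset_Icc_self).aestronglyMeasurable measurableSet_Ioo) C ?_
    rw [ae_restrict_iff' measurableSet_Ioo]
    exact ae_of_all _ fun t ht => hC t (Ioo_subset_Icc_self ht)
  · have hφc : ContinuousOn φ (Icc 0 T) := hφ.1.continuous.continuousOn
    have hgi : IntervalIntegrable (fun t => φ t • g t) volume 0 T := by
      rw [← uIcc_of_le hT] at hg hφc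
      exact (hφc.smul hg).intervalIntegrable
    have hsi : IntervalIntegrable (fun t => φ t * s t) volume 0 T := by
      rw [← uIcc_of_le hT] at hs hφc
      exact (hφc.mul hs).intervalIntegrable
    have hsl : IntervalIntegrable (fun t => (φ t * s t) • W.lift) volume 0 T :=
      intervalIntegrable_clm_comp ((ContinuousLinearMap.id ℝ ℝ).smulRight W.lift) hsi
    set γ := ∫ t in (0 : ℝ)..T, φ t • g t with hγ
    set σ := ∫ t in (0 : ℝ)..T, φ t * s t with hσ
    have h1 : ∫ t in (0 : ℝ)..T, φ t • θ t = W.S γ + σ • W.lift := by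
      have h2 : ∀ t ∈ uIcc 0 T, φ t • θ t = W.S (φ t • g t) + (φ t * s t) • W.lift := fun t ht => by
        rw [uIcc_of_le hT] at ht
        rw [heq t ht, smul_add, map_smul, smul_smul]
      rw [intervalIntegral.integral_congr h2, intervalIntegral.integral_add
        (intervalIntegrable_clm_comp W.S hgi)
        hsl, W.S.intervalIntegral_comp_comm hgi,
        intervalIntegral.integral_smul_const]
    refine ⟨W.slope γ + (σ * W.κ) • W.A (one L), ?_, ?_⟩
    · rw [h1, S_add_smul_lift]
      simpa using W.hasWeakDeriv 0 (W.slope γ + (σ * W.κ) • W.A (one L))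
    · have h3 : ∫ t in (0 : ℝ)..T, l⁻¹ * (W.fluxLeft (g t) + s t * W.κ) * φ t =
          l⁻¹ * (W.fluxLeft γ + σ * W.κ) := by
        rw [← W.fluxLeft.intervalIntegral_comp_comm hgi, hσ, ← intervalIntegral.integral_mul_const,
          ← intervalIntegral.integral_add (intervalIntegrable_clm_comp W.fluxLeft hgi)
          (hsi.mul_const _), ← intervalIntegral.integral_const_mul]
        refine intervalIntegral.integral_congr fun t _ => ?_
        simp only [map_smul, smul_eq_mul]
        ring
      rw [h3]
      exact W.tendsto_slope_zero hl γ _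

end WaveOperators

/-! ### Linearity of the adjoint problem and the first variation of `J`. -/

theorem HasWeakDeriv.add_smul {L : ℝ} {w₁ z₁ w₂ z₂ : L2 L} (k : ℝ) (h₁ : HasWeakDeriv w₁ z₁)
    (h₂ : HasWeakDeriv w₂ z₂) : HasWeakDeriv (w₁ + k • w₂) (z₁ + k • z₂) := by
  obtain ⟨k₁, h₁⟩ := h₁
  obtain ⟨k₂, h₂⟩ := h₂
  refine ⟨k₁ + k * k₂, ?_⟩
  have hz : ∀ᵐ y, y ∈ Ioo 0 L → (z₁ + k • z₂ : L2 L) y = z₁ y + k * z₂ y := by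
    rw [← ae_restrict_iff' measurableSet_Ioo]
    filter_upwards [Lp.coeFn_add z₁ (k • z₂), Lp.coeFn_smul k z₂] with y h3 h4
    rw [h3, Pi.add_apply, h4, Pi.smul_apply, smul_eq_mul]
  filter_upwards [h₁, h₂, Lp.coeFn_add w₁ (k • w₂), Lp.coeFn_smul k w₂,
    ae_restrict_mem measurableSet_Ioo] with x h1 h2 h3 h4 h5
  have hI : ∀ g : L2 L, IntervalIntegrable g volume 0 x := fun g =>
    L2.intervalIntegrable g ⟨le_rfl, (h5.1.trans h5.2).le⟩ ⟨h5.1.le, h5.2.le⟩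
  have h6 : ∫ ξ in (0 : ℝ)..x, (z₁ + k • z₂ : L2 L) ξ =
      (∫ ξ in (0 : ℝ)..x, z₁ ξ) + k * ∫ ξ in (0 : ℝ)..x, z₂ ξ := by
    rw [← intervalIntegral.integral_const_mul,
      ← intervalIntegral.integral_add (hI z₁) ((hI z₂).const_mul k)]
    refine intervalIntegral.integral_congr_ae ?_
    filter_upwards [hz] with y hy hyx
    rw [uIoc_of_le h5.1.le] at hyx
    exact hy ⟨hyx.1, hyx.2.trans_lt h5.2⟩
  rw [h3, Pi.add_apply, h4, Pi.smul_apply, h1, h2, h6, smul_eq_mul]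
  ring

theorem intervalIntegrable_smul_of_continuousOn {E : Type*} [NormedAddCommGroup E] [NormedSpace ℝ E]
    {T : ℝ} (hT : 0 ≤ T) {φ : ℝ → ℝ} {w : ℝ → E} (hφ : Continuous φ)
    (hw : ContinuousOn w (Icc 0 T)) : IntervalIntegrable (fun t => φ t • w t) volume 0 T := by
  rw [← uIcc_of_le hT] at hw
  exact (hφ.continuousOn.smul hw).intervalIntegrable

theorem intervalIntegrable_mul_of_memLp {T : ℝ} (hT : 0 ≤ T) {g φ : ℝ → ℝ}
    (hg : MemLp g 2 (volume.restrict (Ioo 0 T))) (hφ : ContinuousOn φ (Icc 0 T)) :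
    IntervalIntegrable (fun t => g t * φ t) volume 0 T := by
  have h : IntervalIntegrable g volume 0 T := by
    rw [intervalIntegrable_iff_integrableOn_Ioo_of_le hT]
    exact hg.integrable (by norm_num)
  rw [← uIcc_of_le hT] at hφ
  exact h.mul_continuousOn hφ

theorem HasDxTraceZero.add_smul {L T : ℝ} (hT : 0 ≤ T) {w₁ w₂ : ℝ → L2 L} {g₁ g₂ : ℝ → ℝ} (k : ℝ)
    (hw₁ : ContinuousOn w₁ (Icc 0 T)) (hw₂ : ContinuousOn w₂ (Icc 0 T)) (hL : 0 < L)
    (h₁ : HasDxTraceZero T w₁ g₁) (h₂ : HasDxTraceZero T w₂ g₂) :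
    HasDxTraceZero T (fun t => w₁ t + k • w₂ t) fun t => g₁ t + k * g₂ t := by
  refine ⟨h₁.1.add (h₂.1.const_mul k), fun φ hφ => ?_⟩
  have hφc := hφ.1.continuous
  obtain ⟨z₁, hz₁, hl₁⟩ := h₁.2 φ hφ
  obtain ⟨z₂, hz₂, hl₂⟩ := h₂.2 φ hφ
  refine ⟨z₁ + k • z₂, ?_, ?_⟩
  · have hk : IntervalIntegrable (fun t => k • φ t • w₂ t) volume 0 T :=
      (intervalIntegrable_smul_of_continuousOn hT hφc hw₂).smul k
    have h : ∫ t in (0 : ℝ)..T, φ t • (w₁ t + k • w₂ t) =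
        (∫ t in (0 : ℝ)..T, φ t • w₁ t) + k • ∫ t in (0 : ℝ)..T, φ t • w₂ t := by
      rw [← intervalIntegral.integral_smul, ← intervalIntegral.integral_add
        (intervalIntegrable_smul_of_continuousOn hT hφc hw₁) hk]
      refine intervalIntegral.integral_congr fun t _ => ?_
      simp only [smul_add]
      rw [smul_comm]
    rw [h]
    exact hz₁.add_smul k hz₂
  · have h : ∫ t in (0 : ℝ)..T, (g₁ t + k * g₂ t) * φ t =
        (∫ t in (0 : ℝ)..T, g₁ t * φ t) + k * ∫ t in (0 : ℝ)..T, g₂ t * φ t := by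
      rw [← intervalIntegral.integral_const_mul, ← intervalIntegral.integral_add
        (intervalIntegrable_mul_of_memLp hT h₁.1 hφc.continuousOn)
        ((intervalIntegrable_mul_of_memLp hT h₂.1 hφc.continuousOn).const_mul k)]
      refine intervalIntegral.integral_congr fun t _ => ?_
      ring
    rw [h]
    refine (hl₁.add (hl₂.const_mul k)).congr' ?_
    refine eventually_inf_ae_of_ae_restrict (Ioo_mem_nhdsGT hL) ?_
    filter_upwards [Lp.coeFn_add z₁ (k • z₂), Lp.coeFn_smul k z₂] with x h3 h4
    rw [h3, Pi.add_apply, h4, Pi.smul_apply, smul_eq_mul]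

theorem IsFiniteEnergySolution.continuousOn {L T : ℝ} {ρ a s : ℝ → ℝ} {f θ : ℝ → L2 L}
    (h : IsFiniteEnergySolution T ρ a f s θ) : ContinuousOn θ (Icc 0 T) := by
  obtain ⟨_, _, h, -⟩ := h
  exact h

theorem WaveOperators.integral_eq_inner_R {L : ℝ} {ρ a : ℝ → ℝ} (W : WaveOperators L ρ a)
    (w : L2 L) {v : ℝ → ℝ} {d : L2 L}
    (hd : ∀ᵐ x ∂(volume.restrict (Ioo 0 L)), d x = v x) :
    ∫ x in Ioo 0 L, ρ x * w x * v x = inner ℝ (W.R w) d := by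
  rw [inner_eq_setIntegral]
  refine integral_congr_ae ?_
  filter_upwards [W.R_ae w, hd] with x h2 h3
  rw [h2, h3]

/-- Integration against `a dv`, as a bounded functional. -/
theorem exists_integral_eq_inner {L a₀ a₁ : ℝ} {a dv : ℝ → ℝ} (ha₀ : 0 < a₀)
    (ha : ∀ᵐ x ∂(volume.restrict (Ioo 0 L)), a₀ ≤ a x ∧ a x ≤ a₁)
    (ham : AEMeasurable a (volume.restrict (Ioo 0 L)))
    (hdv : MemLp dv 2 (volume.restrict (Ioo 0 L))) :
    ∃ e : L2 L, ∀ z : L2 L, ∫ x in Ioo 0 L, a x * z x * dv x = inner ℝ z e := by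
  obtain ⟨M, hM⟩ := exists_mulOp (C := a₁) ham.aestronglyMeasurable (by
    filter_upwards [ha] with x hx
    rw [abs_of_pos (ha₀.trans_le hx.1)]
    exact hx.2)
  refine ⟨M (hdv.toLp dv), fun z => ?_⟩
  rw [inner_eq_setIntegral]
  refine integral_congr_ae ?_
  filter_upwards [hM (hdv.toLp dv), hdv.coeFn_toLp] with x h1 h2
  rw [h1, h2]
  ring

theorem IsAdjointSolution.add_smul {L T a₀ a₁ : ℝ} {ρ a s₁ s₂ : ℝ → ℝ} {ψ₁ ψ₂ : ℝ → L2 L}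
    (W : WaveOperators L ρ a) (ha₀ : 0 < a₀)
    (ha : ∀ᵐ x ∂(volume.restrict (Ioo 0 L)), a₀ ≤ a x ∧ a x ≤ a₁)
    (ham : AEMeasurable a (volume.restrict (Ioo 0 L))) (k : ℝ)
    (h₁ : IsAdjointSolution T ρ a s₁ ψ₁) (h₂ : IsAdjointSolution T ρ a s₂ ψ₂) :
    IsAdjointSolution T ρ a (fun t => s₁ t + k * s₂ t) fun t => ψ₁ t + k • ψ₂ t := by
  obtain ⟨x₁, v₁, hc₁, hxc₁, hvc₁, hx₁, hv₁, hT₁, hvT₁, he₁⟩ := h₁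
  obtain ⟨x₂, v₂, hc₂, hxc₂, hvc₂, hx₂, hv₂, hT₂, hvT₂, he₂⟩ := h₂
  refine ⟨fun t => x₁ t + k • x₂ t, fun t => v₁ t + k • v₂ t, hc₁.add (hc₂.const_smul k),
    hxc₁.add (hxc₂.const_smul k), hvc₁.add (hvc₂.const_smul k), fun t ht => ⟨?_, ?_⟩,
    fun t ht => (hv₁ t ht).add ((hv₂ t ht).const_smul k), by simp [hT₁, hT₂],
    by simp [hvT₁, hvT₂], fun v dv hv t ht => ?_⟩
  · have e₁ : ψ₁ t = W.P (x₁ t) := Lp.ext (by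
      filter_upwards [(hx₁ t ht).1, W.P_ae (x₁ t)] with x h1 h2
      rw [h1, h2])
    have e₂ : ψ₂ t = W.P (x₂ t) := Lp.ext (by
      filter_upwards [(hx₂ t ht).1, W.P_ae (x₂ t)] with x h1 h2
      rw [h1, h2])
    beta_reduce
    rw [e₁, e₂, ← map_smul, ← map_add]
    exact W.P_ae _
  · rw [← inner_one_left W.L_pos, inner_add_right, real_inner_smul_right, inner_one_left W.L_pos,
      inner_one_left W.L_pos, (hx₁ t ht).2, (hx₂ t ht).2]
  · obtain ⟨d, -, hd, -⟩ := W.exists_of_isH10 hv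
    obtain ⟨e, he⟩ := exists_integral_eq_inner ha₀ ha ham hv.1.1
    have h1 := he₁ v dv hv t ht
    have h2 := he₂ v dv hv t ht
    simp only [W.integral_eq_inner_R _ hd, he] at h1 h2 ⊢
    have hz : ∫ x in Ioo 0 L, (0 : L2 L) x * v x = 0 := by
      refine integral_eq_zero_of_ae ?_
      filter_upwards [Lp.coeFn_zero ℝ 2 (volume.restrict (Ioo 0 L))] with x hx
      rw [hx, Pi.zero_apply, zero_mul]
    rw [hz, zero_sub] at h1 h2 ⊢
    refine HasDerivWithinAt.congr_deriv (f' := -inner ℝ (x₁ t) e + k * -inner ℝ (x₂ t) e)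
      (HasDerivWithinAt.congr_of_mem (h1.add (h2.const_mul k)) (fun τ _ => ?_) ht) ?_
    · simp only [Pi.add_apply, map_add, map_smul, inner_add_left, real_inner_smul_left]
    · rw [inner_add_left, real_inner_smul_left]
      ring

/-- The Euler–Lagrange equation of the functional `J`. -/
theorem euler_lagrange {L T c : ℝ} (hT : 0 ≤ T) {a : ℝ → ℝ} {p : H1Star c T →ₗ[ℝ] ℝ}
    {s σ : H1Star c T} {g γ : ℝ → ℝ} (hg : MemLp g 2 (volume.restrict (Ioo 0 T)))
    (hγ : ContinuousOn γ (Icc 0 T))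
    (h : ∀ k : ℝ, J L a p s g ≤ J L a p (s + k • σ) fun t => g t + k * γ t) :
    Function.rightLim a 0 ^ 2 * ∫ t in (0 : ℝ)..T, g t * γ t = Function.leftLim a L * p σ := by
  set l := Function.rightLim a 0
  have h1 := (intervalIntegrable_mul_of_memLp hT hg hγ).const_mul (l ^ 2)
  have h2 : IntervalIntegrable (fun t => l ^ 2 * γ t ^ 2) volume 0 T := by
    rw [← uIcc_of_le hT] at hγ
    exact (hγ.pow 2).intervalIntegrable.const_mul _
  have h3 : IntervalIntegrable (fun t => (l * g t) ^ 2) volume 0 T := by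
    rw [intervalIntegrable_iff_integrableOn_Ioo_of_le hT]
    exact (hg.const_mul l).integrable_sq
  have key : ∀ k : ℝ, 0 ≤ k * (l ^ 2 * (∫ t in (0 : ℝ)..T, g t * γ t) - Function.leftLim a L * p σ)
      + k ^ 2 * (1 / 2 * ∫ t in (0 : ℝ)..T, l ^ 2 * γ t ^ 2) := fun k => by
    have h4 : ∫ t in (0 : ℝ)..T, (l * (g t + k * γ t)) ^ 2 =
        (∫ t in (0 : ℝ)..T, (l * g t) ^ 2) + (2 * k) * (l ^ 2 * ∫ t in (0 : ℝ)..T, g t * γ t) +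
          k ^ 2 * ∫ t in (0 : ℝ)..T, l ^ 2 * γ t ^ 2 := by
      rw [← intervalIntegral.integral_const_mul (l ^ 2), ← intervalIntegral.integral_const_mul (2 * k),
        ← intervalIntegral.integral_const_mul (k ^ 2),
        ← intervalIntegral.integral_add h3 (h1.const_mul _),
        ← intervalIntegral.integral_add (h3.add (h1.const_mul _)) (h2.const_mul _)]
      refine intervalIntegral.integral_congr fun t _ => ?_
      ring
    have h5 := h k
    simp only [J] at h5
    rw [h4, map_add, map_smul, smul_eq_mul] at h5
    nlinarith
  set X := l ^ 2 * (∫ t in (0 : ℝ)..T, g t * γ t) - Function.leftLim a L * p σ with hX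
  set Z := 1 / 2 * ∫ t in (0 : ℝ)..T, l ^ 2 * γ t ^ 2
  -- The polynomial `Z k² + X k` is nonnegative for all real `k`, so its discriminant `X²` is at
  -- most `0`.
  have hdisc := discrim_le_zero (a := Z) (b := X) (c := 0) fun k => by nlinarith [key k]
  have : X = 0 := by
    rw [discrim] at hdisc
    nlinarith [sq_nonneg X]
  linarith

/-! ### Time-regular adjoint solutions for test data. -/

theorem iteratedDeriv_hasDerivAt {φ : ℝ → ℝ} (hφ : ContDiff ℝ ∞ φ) (n : ℕ) (t : ℝ) :
    HasDerivAt (iteratedDeriv n φ) (iteratedDeriv (n + 1) φ t) t := by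
  rw [iteratedDeriv_succ]
  exact (hφ.differentiable_iteratedDeriv n (by exact_mod_cast WithTop.coe_lt_top _)
    t).hasDerivAt

theorem IsTest.iteratedDeriv_right {c T : ℝ} {φ : ℝ → ℝ} (h : IsTest c T φ)
    (n : ℕ) : iteratedDeriv n φ T = 0 := by
  have hT : T ∉ tsupport φ := fun h' => lt_irrefl _ (h.2.2 h').2
  rw [(notMem_tsupport_iff_eventuallyEq.1 hT).iteratedDeriv_eq]
  simp

namespace WaveOperators

variable {L : ℝ} {ρ a : ℝ → ℝ} (W : WaveOperators L ρ a)

/-- For a test function `φ` of time, the backward problem with the source `-φ'' ρ ℓ` and homogeneous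
boundary data, where `ℓ` is the lift of the boundary values `0` and `1`, has a solution `θ` which is
twice continuously differentiable in time; here `q = -φ'' ρ ℓ - ρ θ''`. -/
theorem exists_homogeneous_part {c T : ℝ} (hT : 0 < T) {φ : ℝ → ℝ} (hφ : IsTest c T φ) :
    ∃ (q θ θ' θ'' : ℝ → L2 L), ContinuousOn q (Icc 0 T) ∧
      ContinuousOn θ'' (Icc 0 T) ∧
      (∀ t ∈ Icc 0 T, HasDerivWithinAt θ (θ' t) (Icc 0 T) t) ∧
      (∀ t ∈ Icc 0 T, HasDerivWithinAt θ' (θ'' t) (Icc 0 T) t) ∧ θ T = 0 ∧ θ' T = 0 ∧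
      (∀ t ∈ Icc 0 T, θ t = W.S (q t)) ∧
      ∀ t, q t = -(iteratedDeriv 2 φ t • W.R W.lift) - W.R (θ'' t) := by
  -- With `τ = T + 1` the closed interval `[0, T]` lies inside the open interval on which the
  -- derivatives are available.
  obtain ⟨D, hDT, hD, hDe⟩ := exists_evolution (T := T) (τ := T + 1) W.r_pos (by linarith)
    W.inner_S_comm W.inner_S_nonneg W.inner_R_comm W.le_inner_R
    (c := fun n t => iteratedDeriv (n + 2) φ t • -(W.S (W.R W.lift)))
    (fun n t => (iteratedDeriv_hasDerivAt hφ.1 (n + 2) t).smul_const _)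
    (fun n => by simp [hφ.iteratedDeriv_right])
  have hmem : ∀ t ∈ Icc 0 T, t ∈ Ioo (T - (T + 1)) (T + (T + 1)) := fun t ht =>
    ⟨by linarith [ht.1], by linarith [ht.2]⟩
  have hc : ContinuousOn (D 2) (Icc 0 T) := fun t ht =>
    (hD 2 t (hmem t ht)).continuousAt.continuousWithinAt
  have hφ2 : Continuous (iteratedDeriv 2 φ) :=
    continuous_iff_continuousAt.2 fun t => (iteratedDeriv_hasDerivAt hφ.1 2 t).continuousAt
  refine ⟨fun t => -(iteratedDeriv 2 φ t • W.R W.lift) - W.R (D 2 t), D 0, D 1, D 2, ?_, hc,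
    fun t ht => (hD 0 t (hmem t ht)).hasDerivWithinAt,
    fun t ht => (hD 1 t (hmem t ht)).hasDerivWithinAt, hDT 0, hDT 1, fun t ht => ?_, fun t => rfl⟩
  · exact ((hφ2.smul continuous_const).neg.continuousOn).sub (W.R.continuous.comp_continuousOn hc)
  · have h := hDe 0 t (Ioo_subset_Icc_self (hmem t ht))
    simp only [zero_add, smul_neg] at h
    rw [map_sub, map_neg, map_smul, eq_comm, ← h]
    abel

end WaveOperators

end Sidewise

/-! ### The flux of the controlled state at `L`. -/

open Sidewise in
theorem lemma2p1 (L T : ℝ) (hL : 0 < L) (ρ a : ℝ → ℝ) (ρ₀ ρ₁ a₀ a₁ : ℝ)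
    (hρ₀ : 0 < ρ₀) (ha₀ : 0 < a₀)
    (hρ : ∀ᵐ x ∂(volume.restrict (Ioo 0 L)), ρ₀ ≤ ρ x ∧ ρ x ≤ ρ₁)
    (ha : ∀ᵐ x ∂(volume.restrict (Ioo 0 L)), a₀ ≤ a x ∧ a x ≤ a₁)
    (hρBV : BoundedVariationOn ρ (Ioo 0 L)) (haBV : BoundedVariationOn a (Ioo 0 L))
    (hT : L * beta L ρ a < T)
    -- the target `p`
    (p : H1Star (L * beta L ρ a) T →ₗ[ℝ] ℝ) (hp : IsDual p)
    -- the minimizer `sbar` of `J`, the adjoint solution `ψbar`, and `gbar = ∂ₓ ψbar (0, ·)`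
    (sbar : H1Star (L * beta L ρ a) T) (ψbar : ℝ → L2 L) (gbar : ℝ → ℝ)
    (hψbar : IsAdjointSolution T ρ a sbar ψbar) (hgbar : HasDxTraceZero T ψbar gbar)
    (hmin : ∀ (s : H1Star (L * beta L ρ a) T) (g : ℝ → ℝ),
      IsAdjointTrace L T ρ a s g → J L a p sbar gbar ≤ J L a p s g)
    -- the control `u`
    (u : ℝ → ℝ) (hu : ∀ t, u t = -(Function.rightLim a 0 * gbar t)) :
    MemLp u 2 (volume.restrict (Ioo 0 T)) ∧
      ∀ y : ℝ → L2 L, IsTranspositionSolution T ρ a u y →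
        ∀ (φ : ℝ → ℝ) (hφ : IsTest (L * beta L ρ a) T φ),
          HasDxTrace T (𝓝[<] L) y φ (p ⟨φ, hφ.mem_H1Star⟩) := by
  have hu2 : MemLp u 2 (volume.restrict (Ioo 0 T)) := by
    rw [funext hu]
    exact (hgbar.1.const_mul _).neg
  refine ⟨hu2, fun y hy φ hφ => ?_⟩
  have hT0 : 0 < T := (mul_nonneg hL.le (beta_nonneg hL ρ a)).trans_lt hT
  have ham := aemeasurable_of_boundedVariationOn haBV
  obtain ⟨W⟩ := nonempty_waveOperators hL hρ₀ ha₀ hρ ha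
    (aemeasurable_of_boundedVariationOn hρBV) ham
  have hl := tendsto_rightLim_zero hL haBV
  have hr := tendsto_leftLim_right_end hL haBV
  have hl0 := W.pos_of_tendsto_zero hl
  have hr0 := W.pos_of_tendsto_right hr
  set l := Function.rightLim a 0 with hldef
  set lr := Function.leftLim a L with hlrdef
  have hd0 : ∀ t, HasDerivAt φ (iteratedDeriv 1 φ t) t := fun t => by
    simpa [iteratedDeriv_zero] using iteratedDeriv_hasDerivAt hφ.1 0 t
  have hd1 : ∀ t, HasDerivAt (iteratedDeriv 1 φ) (iteratedDeriv 2 φ t) t :=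
    iteratedDeriv_hasDerivAt hφ.1 1
  have hφc : Continuous φ := hφ.1.continuous
  have hφ2c : Continuous (iteratedDeriv 2 φ) := continuous_iff_continuousAt.2 fun t =>
    (iteratedDeriv_hasDerivAt hφ.1 2 t).continuousAt
  have hφT : φ T = 0 := by simpa using hφ.iteratedDeriv_right 0
  obtain ⟨q, θ, θ', θ'', hqc, hθ''c, hθ, hθ', hθT, hθ'T, hθq, hq⟩ := W.exists_homogeneous_part hT0 hφ
  have hGc : ContinuousOn (fun t => W.fluxLeft (q t)) (Icc 0 T) :=
    W.fluxLeft.continuous.comp_continuousOn hqc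
  -- the adjoint solution with the boundary datum `φ`
  have hψ : IsAdjointSolution T ρ a φ fun t => θ t + φ t • W.lift := by
    refine W.isFiniteEnergySolution_of_eq (θ' := fun t => θ' t + iteratedDeriv 1 φ t • W.lift)
      (θ'' := fun t => θ'' t + iteratedDeriv 2 φ t • W.lift) continuousOn_const hφc.continuousOn
      (fun t ht => (hθ t ht).add ((hd0 t).hasDerivWithinAt.smul_const _))
      (fun t ht => (hθ' t ht).add ((hd1 t).hasDerivWithinAt.smul_const _))
      (hθ''c.add (hφ2c.continuousOn.smul continuousOn_const)) (by simp [hθT, hφT])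
      (by simp [hθ'T, hφ.iteratedDeriv_right]) fun t ht => ?_
    -- The source of `θ` is exactly `-ρ` times the second time derivative of the lift term.
    rw [hθq t ht, hq t, map_add, map_smul]
    congr 2
    abel
  have hψg : HasDxTraceZero T (fun t => θ t + φ t • W.lift)
      fun t => l⁻¹ * (W.fluxLeft (q t) + φ t * W.κ) :=
    W.hasDxTraceZero_of_eq hT0.le hl hqc hφc.continuousOn fun t ht => by rw [hθq t ht]
  -- the Euler–Lagrange equation
  have hEL := euler_lagrange (L := L) (p := p) (s := sbar) (σ := ⟨φ, hφ.mem_H1Star⟩) hT0.le hgbar.1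
    (γ := fun t => l⁻¹ * (W.fluxLeft (q t) + φ t * W.κ))
    (continuousOn_const.mul (hGc.add (hφc.continuousOn.mul continuousOn_const))) fun k =>
    hmin _ _ ⟨_, hψbar.add_smul W ha₀ ha ham k hψ,
      hgbar.add_smul hT0.le k hψbar.continuousOn hψ.continuousOn hL hψg⟩
  rw [← hldef, ← hlrdef] at hEL
  have huφ := intervalIntegrable_mul_of_memLp hT0.le hu2 hφc.continuousOn
  have huG := intervalIntegrable_mul_of_memLp hT0.le hu2 hGc
  set U := ∫ t in (0 : ℝ)..T, u t * φ t with hU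
  set V := ∫ t in (0 : ℝ)..T, u t * W.fluxLeft (q t) with hV
  -- The Euler–Lagrange equation after substituting `u = -l gbar`; one factor `l` goes into `u`, the
  -- other cancels the `l⁻¹` of the trace.
  have hpV : -V - U * W.κ = lr * p ⟨φ, hφ.mem_H1Star⟩ := by
    rw [← neg_add', ← hEL, hU, hV, ← intervalIntegral.integral_mul_const,
      ← intervalIntegral.integral_add huG (huφ.mul_const _), ← intervalIntegral.integral_neg,
      ← intervalIntegral.integral_const_mul]
    refine intervalIntegral.integral_congr fun t _ => ?_
    simp only [hu]
    field_simp
    ring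
  have hyc := hy.1
  set Y := ∫ t in (0 : ℝ)..T, φ t • y t with hY
  set Y2 := ∫ t in (0 : ℝ)..T, iteratedDeriv 2 φ t • y t with hY2
  have hint : ∀ {χ : ℝ → ℝ} (w : L2 L), Continuous χ →
      ∫ t in (0 : ℝ)..T, χ t * inner ℝ (y t) w = inner ℝ (∫ t in (0 : ℝ)..T, χ t • y t) w :=
    fun {χ} w hχ => by
      rw [real_inner_comm, ← innerSL_apply_apply ℝ, ← ContinuousLinearMap.intervalIntegral_comp_comm _
        (intervalIntegrable_smul_of_continuousOn hT0.le hχ hyc)]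
      refine intervalIntegral.integral_congr fun t _ => ?_
      simp [real_inner_comm]
  have hinti : ∀ {χ : ℝ → ℝ} (w : L2 L), Continuous χ →
      IntervalIntegrable (fun t => χ t * inner ℝ (y t) w) volume 0 T := fun {χ} w hχ =>
    intervalIntegrable_smul_of_continuousOn hT0.le hχ (hyc.inner continuousOn_const)
  -- transposition against the homogeneous part of the adjoint solution
  have hV2 : W.fluxRight (W.R Y2) = -V := by
    have h := hy.2 (fun t => -(iteratedDeriv 2 φ t • W.R W.lift)) θ
      (fun t => l⁻¹ * (W.fluxLeft (q t) + 0 * W.κ))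
      (hφ2c.continuousOn.smul continuousOn_const).neg
      (W.isFiniteEnergySolution_of_eq (hφ2c.continuousOn.smul continuousOn_const).neg
        continuousOn_const hθ hθ' hθ''c hθT hθ'T fun t ht => by
          rw [hθq t ht, hq t, zero_smul, add_zero])
      (W.hasDxTraceZero_of_eq hT0.le hl hqc (s := fun _ => 0) continuousOn_const fun t ht => by
        rw [hθq t ht, zero_smul, add_zero])
    have h1 : ∫ t in (0 : ℝ)..T, inner ℝ (y t) (-(iteratedDeriv 2 φ t • W.R W.lift)) =
        -inner ℝ Y2 (W.R W.lift) := by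
      rw [hY2, ← hint _ hφ2c, ← intervalIntegral.integral_neg]
      refine intervalIntegral.integral_congr fun t _ => ?_
      simp only [inner_neg_right, real_inner_smul_right]
    have h2 : ∫ t in (0 : ℝ)..T, l * (l⁻¹ * (W.fluxLeft (q t) + 0 * W.κ)) * u t = V := by
      refine intervalIntegral.integral_congr fun t _ => ?_
      simp only [zero_mul, add_zero]
      rw [mul_inv_cancel_left₀ hl0.ne', mul_comm]
    rw [← hldef, h1, h2] at h
    rw [W.fluxRight_eq_inner_lift, ← W.inner_R_comm, real_inner_comm, ← h, neg_neg]
  -- transposition against separated functions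
  have hYeq : Y = U • (one L - W.lift) - W.S (W.R Y2) := by
    refine ext_inner_right ℝ fun g => ?_
    have h := hy.2 (fun t => iteratedDeriv 2 φ t • W.R (W.S g) + φ t • g) (fun t => φ t • W.S g)
      (fun t => l⁻¹ * (W.fluxLeft (φ t • g) + 0 * W.κ))
      ((hφ2c.continuousOn.smul continuousOn_const).add (hφc.continuousOn.smul continuousOn_const))
      (W.isFiniteEnergySolution_of_eq ((hφ2c.continuousOn.smul continuousOn_const).add
          (hφc.continuousOn.smul continuousOn_const))
        continuousOn_const (θ' := fun t => iteratedDeriv 1 φ t • W.S g)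
        (θ'' := fun t => iteratedDeriv 2 φ t • W.S g)
        (fun t _ => (hd0 t).hasDerivWithinAt.smul_const _)
        (fun t _ => (hd1 t).hasDerivWithinAt.smul_const _)
        (hφ2c.continuousOn.smul continuousOn_const) (by simp [hφT])
        (by simp [hφ.iteratedDeriv_right]) fun t _ => by
          rw [map_smul W.R, add_sub_cancel_left, map_smul, zero_smul, add_zero])
      (W.hasDxTraceZero_of_eq hT0.le hl (hφc.continuousOn.smul continuousOn_const)
        (s := fun _ => 0) continuousOn_const fun t _ => by rw [map_smul, zero_smul, add_zero])
    have h1 : ∫ t in (0 : ℝ)..T, inner ℝ (y t) (iteratedDeriv 2 φ t • W.R (W.S g) + φ t • g) =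
        inner ℝ Y2 (W.R (W.S g)) + inner ℝ Y g := by
      rw [hY2, hY, ← hint _ hφ2c, ← hint _ hφc,
        ← intervalIntegral.integral_add (hinti _ hφ2c) (hinti _ hφc)]
      refine intervalIntegral.integral_congr fun t _ => ?_
      simp only [inner_add_right, real_inner_smul_right]
    have h2 : ∫ t in (0 : ℝ)..T, l * (l⁻¹ * (W.fluxLeft (φ t • g) + 0 * W.κ)) * u t =
        U * W.fluxLeft g := by
      rw [hU, ← intervalIntegral.integral_mul_const]
      refine intervalIntegral.integral_congr fun t _ => ?_
      simp only [zero_mul, add_zero, map_smul, smul_eq_mul]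
      rw [mul_inv_cancel_left₀ hl0.ne']
      ring
    rw [← hldef, h1, h2] at h
    rw [inner_sub_left, real_inner_smul_left, ← W.fluxLeft_eq_inner, ← h, W.inner_S_comm,
      W.inner_R_comm]
    ring
  -- By `hYeq`, `Y` is the constant `U` plus the primitive of this element. Its limit at `L` is
  -- `lr⁻¹ (-U κ - V)` by `hV2`, which is the value of `p` by `hpV`.
  refine ⟨W.slope (-W.R Y2) + (-(U * W.κ)) • W.A (one L), ?_, ?_⟩
  · rw [← hY, hYeq]
    convert W.hasWeakDeriv U (W.slope (-W.R Y2) + (-(U * W.κ)) • W.A (one L)) using 1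
    rw [← neg_mul, ← W.S_add_smul_lift, map_neg, smul_sub, neg_smul]
    abel
  · convert W.tendsto_slope_right hr (-W.R Y2) (-(U * W.κ)) using 2
    rw [map_neg, hV2, eq_inv_mul_iff_mul_eq₀ hr0.ne', ← hpV]
    ring
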